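/- **Setting.** A finite 2-complex $Y=(V,E,F)$ consists of a finite graph with oriented edges (each edge $e$ has an inverse $e^{-1}\neq e$) and finitely many oriented faces; every face $f$ has a boundary $\partial f$, a nontrivial cyclically reduced loop of the graph with a starting point, and an inverse face with $\partial(f^{-1})=(\partial f)^{-1}$. A geometric edge (face) is a pair of mutually inverse edges (faces); $|Y|$ is the number of geometric faces. $Y$ is planar if it can be embedded in the plane. For a planar $Y$, $|\partial Y|$ is the number of geometric edges adjacent to exactly one face plus twice the number of geometric edges adjacent to no face (adjacency being counted with multiplicity). A geometric form $(Y,\lambda)$ is a finite connected 2-complex $Y$ in which every edge lies on the boundary of a face, together with lengths $\lambda_e\in\,]0,1]$ of its geometric edges such that every face boundary has total length at most $1$. A sequence $(D_\ell)$ is of this geometric form if, for $\ell$ large, $D_\ell$ is obtained from $Y$ by dividing every geometric edge $e$ into $\lambda_e\ell+o(\ell)$ edges of length $1$, such that every face boundary of $D_\ell$ has length at most $\ell$. Fix $m\ge 2$, and let $B_\ell$ be the set of cyclically reduced words of length at most $\ell$ in $x_1^{\pm},\dots,x_m^{\pm}$. Let $(R_\ell)$ be a sequence of random subsets of $B_\ell$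 such that the law of $R_\ell$ is invariant under all permutations of $B_\ell$, and $\log_{|B_\ell|}|R_\ell|$ converges in probability to a real number $d$ (so that $d\in[0,1]$). The sequence of random groups at density $d$ is $G_\ell(m,d)=\langle x_1,\dots,x_m\mid R_\ell\rangle$. A van Kampen 2-complex of $\langle X\mid R\rangle$ is a 2-complex with labels $\varphi_1$ of its oriented edges in $X^{\pm}$ and $\varphi_2$ of its oriented faces in $R^{\pm}$ such that $\varphi_1(e^{-1})=\varphi_1(e)^{-1}$, $\varphi_2(f^{-1})=\varphi_2(f)^{-1}$ and $\varphi_1(\partial f)=\varphi_2(f)$. It is reduced if no two different oriented faces have the same label and a common oriented edge at the same position of their boundaries. A 2-complex is fillable by $\langle X\mid R\rangle$ if it is the underlying 2-complex of a reduced van Kampen 2-complex of $\langle X\mid R\rangle$. **Corollary.** Let $(G_\ell(m,d))$ be a sequence of random groups with $m\ge 2$ generators at density $d$, and let $s>0$. Let $(D_\ell)$ be a sequence of finite planar 2-complexes of the same geometric form such that every face boundary of $D_\ell$ has length exactly $\ell$ for all large $\ell$. If, for all large $\ell$, every sub-2-complex $D'_\ell$ of $D_\ell$ satisfies $$|\partial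 D'_\ell|\ \ge\ (1-2d+s)\,|D'_\ell|\,\ell ,$$ then asymptotically almost surely $D_\ell$ is fillable by $G_\ell(m,d)$, i.e. the probability that $D_\ell$ is fillable by $G_\ell(m,d)$ tends to $1$ as $\ell\to\infty$. -/

import Mathlib

open Filter Topology MeasureTheory

namespace RandomGroups

/-! ### Finite combinatorial 2-complexes

A geometric edge `e` is stored with a reference orientation; the two oriented edges over it are
`(e, true)` (from `src e` to `tgt e`) and `(e, false)` (the inverse edge).  Likewise a geometric
face `f` is stored with a reference boundary loop `bdry f`, and the two oriented faces over it are
`(f, true)` and `(f, false)`, the boundary of the latter being the inverse loop.  The inverse of a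
word in oriented edges, or in letters `x_i^±`, is `FreeGroup.invRev`. -/

/-- A finite graph with vertices `V` and geometric edges `E` (loops and multiple edges allowed). -/
structure FinGraph where
  V : Type
  E : Type
  [finV : Finite V]
  [finE : Finite E]
  src : E → V
  tgt : E → V

namespace FinGraph

attribute [instance] finV finE

/-- Oriented edges. -/
abbrev Dart (G : FinGraph) : Type := G.E × Bool

/-- Starting point of an oriented edge. -/
def init (G : FinGraph) (a : G.Dart) : G.V := if a.2 then G.src a.1 else G.tgt a.1

/-- Ending point of an oriented edge. -/
def term (G : FinGraph) (a : G.Dart) : G.V := if a.2 then G.tgt a.1 else G.src a.1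

/-- The oriented edge `b` may follow the oriented edge `a` in a reduced path: it starts where `a`
ends, and it is not the inverse of `a`. -/
def Follows (G : FinGraph) (a b : G.Dart) : Prop :=
  G.term a = G.init b ∧ (a.1 = b.1 → a.2 = b.2)

/-- A nontrivial cyclically reduced loop, given from its starting point. -/
def IsReducedLoop (G : FinGraph) (l : List G.Dart) : Prop :=
  l ≠ [] ∧ Cycle.Chain G.Follows (l : Cycle G.Dart)

/-- The connected components. -/
def Component (G : FinGraph) : Type := Quot fun v w : G.V => ∃ a : G.Dart, G.init a = v ∧ G.term a = w

/-- The connected component of a vertex. -/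
def component (G : FinGraph) (v : G.V) : G.Component := Quot.mk _ v

/-- Reversal of oriented edges, as a permutation. -/
def flip (G : FinGraph) : Equiv.Perm G.Dart where
  toFun a := (a.1, !a.2)
  invFun a := (a.1, !a.2)
  left_inv a := by simp
  right_inv a := by simp

/-- A rotation system: a cyclic order on the oriented edges that start at each vertex. -/
def IsRotation (G : FinGraph) (σ : Equiv.Perm G.Dart) : Prop :=
  ∀ a b, σ.SameCycle a b ↔ G.init a = G.init b

/-- The face-tracing permutation of a rotation system: traverse `a`, then take the next oriented
edge in the rotation at its end. Its cycles are the boundary walks of the regions that are cut out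
by the graph, drawn on a surface with this rotation system. -/
def trace (G : FinGraph) (σ : Equiv.Perm G.Dart) : Equiv.Perm G.Dart := σ * G.flip

/-- Euler's formula `#vertices - #edges + #regions = 2` for every component, summed over
the components. As the genus of each component is nonnegative, this says that the rotation system
draws every component on a sphere. (A component that consists of one vertex has one region, which
no oriented edge sees.) -/
def IsSpherical (G : FinGraph) (σ : Equiv.Perm G.Dart) : Prop :=
  Nat.card G.V + (Nat.card (Quotient (Equiv.Perm.SameCycle.setoid (G.trace σ))) +
      Nat.card {v : G.V // ∀ a : G.Dart, G.init a ≠ v}) =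
    Nat.card G.E + 2 * Nat.card G.Component

end FinGraph

/-- A finite oriented combinatorial 2-complex with geometric faces `F`. -/
structure TwoComplex extends FinGraph where
  F : Type
  [finF : Finite F]
  bdry : F → List (E × Bool)
  isReducedLoop_bdry : ∀ f, toFinGraph.IsReducedLoop (bdry f)

namespace TwoComplex

attribute [instance] finF

/-- The boundary loop of an oriented face. -/
def orientedBdry (Y : TwoComplex) (f : Y.F × Bool) : List Y.Dart :=
  if f.2 then Y.bdry f.1 else FreeGroup.invRev (Y.bdry f.1)

/-- Connected (and nonempty). -/
def IsConnected (Y : TwoComplex) : Prop := Nat.card Y.Component = 1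

/-- Every geometric edge lies on the boundary of some face. -/
def NoIsolatedEdges (Y : TwoComplex) : Prop := ∀ e : Y.E, ∃ f : Y.F, ∃ a ∈ Y.bdry f, a.1 = e

/-- Planarity: the 1-skeleton has a drawing in which every component lies on a sphere, such that
the faces, with suitable orientations, are distinct regions of the drawing, and in every component
at least one region (which contains the point at infinity of the plane) is not a face. -/
def IsPlanar (Y : TwoComplex) : Prop :=
  ∃ σ : Equiv.Perm Y.Dart, Y.IsRotation σ ∧ Y.IsSpherical σ ∧
    ∃ o : Y.F → Bool,
      (∀ f, (Y.orientedBdry (f, o f)).Nodup ∧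
        Cycle.Chain (fun a b => Y.trace σ a = b) (Y.orientedBdry (f, o f) : Cycle Y.Dart)) ∧
      (∀ f g, f ≠ g → (Y.orientedBdry (f, o f)).Disjoint (Y.orientedBdry (g, o g))) ∧
      ∀ a : Y.Dart, ∃ b : Y.Dart, Y.component (Y.init b) = Y.component (Y.init a) ∧
        ∀ f, b ∉ Y.orientedBdry (f, o f)

/-- A sub-2-complex. -/
structure Sub (Y : TwoComplex) where
  verts : Set Y.V
  edges : Set Y.E
  faces : Set Y.F
  src_mem : ∀ e ∈ edges, Y.src e ∈ verts
  tgt_mem : ∀ e ∈ edges, Y.tgt e ∈ verts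
  bdry_mem : ∀ f ∈ faces, ∀ a ∈ Y.bdry f, a.1 ∈ edges

/-- The number of faces of `Z` adjacent to the edge `e`, counted with multiplicity: the number of
passages of the boundary loops of the faces of `Z` through `e`, in either direction. -/
noncomputable def Sub.adjacency {Y : TwoComplex} (Z : Y.Sub) (e : Y.E) : ℕ :=
  {p : Y.F × ℕ | p.1 ∈ Z.faces ∧ ∃ b : Bool, (Y.bdry p.1)[p.2]? = some (e, b)}.ncard

/-- The boundary length `|∂Z|`: edges adjacent to one face count once, edges adjacent to no face
count twice. -/
noncomputable def Sub.bdryLength {Y : TwoComplex} (Z : Y.Sub) : ℕ :=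
  {e ∈ Z.edges | Z.adjacency e = 1}.ncard + 2 * {e ∈ Z.edges | Z.adjacency e = 0}.ncard

/-! ### Subdivision -/

section Subdivide

variable (Y : TwoComplex) (n : Y.E → ℕ+)

/-- The `i`-th vertex (`0 ≤ i ≤ n e`) on the edge `e` divided into `n e` edges. -/
def divPoint (e : Y.E) (i : ℕ) : Y.V ⊕ (Σ e : Y.E, Fin ((n e : ℕ) - 1)) :=
  if i = 0 then Sum.inl (Y.src e)
  else if h : i - 1 < (n e : ℕ) - 1 then Sum.inr ⟨e, ⟨i - 1, h⟩⟩
  else Sum.inl (Y.tgt e)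

/-- The graph obtained by dividing every edge `e` into `n e` edges. -/
def divGraph : FinGraph where
  V := Y.V ⊕ (Σ e : Y.E, Fin ((n e : ℕ) - 1))
  E := Σ e : Y.E, Fin (n e : ℕ)
  src x := Y.divPoint n x.1 x.2
  tgt x := Y.divPoint n x.1 (x.2 + 1)

/-- The path into which an oriented edge is divided. -/
def divPath (a : Y.Dart) : List (Y.divGraph n).Dart :=
  let p : List (Y.divGraph n).Dart :=
    (List.finRange (n a.1 : ℕ)).map fun i => (⟨a.1, i⟩, true)
  if a.2 then p else FreeGroup.invRev p

theorem divPath_eq (a : Y.Dart) : Y.divPath n a =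
    if a.2 then (List.ofFn fun i : Fin (n a.1 : ℕ) =>
      ((⟨a.1, i⟩, true) : (Y.divGraph n).Dart))
    else (List.ofFn fun i : Fin (n a.1 : ℕ) =>
      ((⟨a.1, i⟩, false) : (Y.divGraph n).Dart)).reverse := by
  unfold divPath
  split_ifs <;> simp [FreeGroup.invRev, List.ofFn_eq_map, Function.comp_def]

theorem divPath_ne_nil (a : Y.Dart) : Y.divPath n a ≠ [] := by
  have := (n a.1).pos
  rw [divPath_eq]
  split_ifs <;> simp [List.ofFn_eq_nil_iff]

theorem isChain_divPath (a : Y.Dart) : (Y.divPath n a).IsChain (Y.divGraph n).Follows := by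
  rw [divPath_eq]
  split_ifs
  · rw [List.isChain_ofFn]
    intro i hi
    simp [FinGraph.Follows, FinGraph.term, FinGraph.init, divGraph]
  · rw [List.isChain_reverse, List.isChain_ofFn]
    intro i hi
    simp [FinGraph.Follows, FinGraph.term, FinGraph.init, divGraph]

theorem divPoint_zero (e : Y.E) : Y.divPoint n e 0 = Sum.inl (Y.src e) := by simp [divPoint]

theorem divPoint_last (e : Y.E) : Y.divPoint n e (n e) = Sum.inl (Y.tgt e) := by
  simp [divPoint]

theorem head_divPath (a : Y.Dart) : ∀ y ∈ (Y.divPath n a).head?,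
    y.1.1 = a.1 ∧ y.2 = a.2 ∧ (Y.divGraph n).init y = Sum.inl (Y.init a) := by
  obtain ⟨e, b⟩ := a
  have hpos := (n e).pos
  intro y hy
  rw [divPath_eq] at hy
  cases b
  · simp only [Bool.false_eq_true, if_false, List.head?_reverse, List.getLast?_eq_getElem?,
      List.length_ofFn, List.getElem?_ofFn, Option.mem_def, Option.dite_none_right_eq_some,
      Option.some.injEq] at hy
    obtain ⟨_, rfl⟩ := hy
    refine ⟨rfl, rfl, ?_⟩
    have : (n e : ℕ) - 1 + 1 = n e := by omega
    simp [FinGraph.init, divGraph, this, divPoint_last]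
  · simp only [if_true, List.head?_eq_getElem?, List.getElem?_ofFn, Option.mem_def,
      Option.dite_none_right_eq_some, Option.some.injEq] at hy
    obtain ⟨_, rfl⟩ := hy
    exact ⟨rfl, rfl, by simp [FinGraph.init, divGraph, divPoint_zero]⟩

theorem getLast_divPath (a : Y.Dart) : ∀ y ∈ (Y.divPath n a).getLast?,
    y.1.1 = a.1 ∧ y.2 = a.2 ∧ (Y.divGraph n).term y = Sum.inl (Y.term a) := by
  obtain ⟨e, b⟩ := a
  have hpos := (n e).pos
  intro y hy
  rw [divPath_eq] at hy
  cases b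
  · simp only [Bool.false_eq_true, if_false, List.getLast?_reverse, List.head?_eq_getElem?,
      List.getElem?_ofFn, Option.mem_def, Option.dite_none_right_eq_some,
      Option.some.injEq] at hy
    obtain ⟨_, rfl⟩ := hy
    exact ⟨rfl, rfl, by simp [FinGraph.term, divGraph, divPoint_zero]⟩
  · simp only [if_true, List.getLast?_eq_getElem?, List.length_ofFn, List.getElem?_ofFn,
      Option.mem_def, Option.dite_none_right_eq_some, Option.some.injEq] at hy
    obtain ⟨_, rfl⟩ := hy
    refine ⟨rfl, rfl, ?_⟩
    have : (n e : ℕ) - 1 + 1 = n e := by omega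
    simp [FinGraph.term, divGraph, this, divPoint_last]

theorem follows_divPath {a b : Y.Dart} (h : Y.Follows a b) :
    ∀ x ∈ (Y.divPath n a).getLast?, ∀ y ∈ (Y.divPath n b).head?,
      (Y.divGraph n).Follows x y := by
  intro x hx y hy
  obtain ⟨hx1, hx2, hx3⟩ := Y.getLast_divPath n a x hx
  obtain ⟨hy1, hy2, hy3⟩ := Y.head_divPath n b y hy
  refine ⟨by rw [hx3, hy3, h.1], fun hxy => ?_⟩
  rw [hx2, hy2]
  exact h.2 (by rw [← hx1, ← hy1, hxy])

theorem isReducedLoop_divide {l : List Y.Dart} (h : Y.IsReducedLoop l) :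
    (Y.divGraph n).IsReducedLoop (l.flatMap (Y.divPath n)) := by
  obtain ⟨h0, h1⟩ := h
  obtain ⟨a, t, rfl⟩ := List.exists_cons_of_ne_nil h0
  have key : ((a :: (t ++ [a])).flatMap (Y.divPath n)).IsChain (Y.divGraph n).Follows := by
    rw [List.flatMap_def, List.isChain_flatten]
    · refine ⟨?_, ?_⟩
      · intro p hp
        obtain ⟨c, -, rfl⟩ := List.mem_map.1 hp
        exact Y.isChain_divPath n c
      · rw [List.isChain_map]
        exact List.IsChain.imp (fun _ _ hab => Y.follows_divPath n hab)
          ((Cycle.chain_coe_cons _ _ _).1 h1)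
    · intro hp
      obtain ⟨c, -, hc⟩ := List.mem_map.1 hp
      exact Y.divPath_ne_nil n c hc
  obtain ⟨x, p, hp⟩ := List.exists_cons_of_ne_nil (Y.divPath_ne_nil n a)
  have e1 : (a :: t).flatMap (Y.divPath n) = x :: (p ++ t.flatMap (Y.divPath n)) := by
    simp [List.flatMap_cons, hp]
  have e2 : (a :: (t ++ [a])).flatMap (Y.divPath n) =
      (x :: ((p ++ t.flatMap (Y.divPath n)) ++ [x])) ++ p := by
    simp [List.flatMap_cons, List.flatMap_append, hp]
  rw [e2] at key
  rw [e1]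
  exact ⟨by simp, (Cycle.chain_coe_cons _ _ _).2 key.left_of_append⟩

/-- The 2-complex obtained from `Y` by dividing every edge `e` into `n e` edges. -/
def subdivide : TwoComplex where
  toFinGraph := Y.divGraph n
  F := Y.F
  bdry f := (Y.bdry f).flatMap (Y.divPath n)
  isReducedLoop_bdry f := Y.isReducedLoop_divide n (Y.isReducedLoop_bdry f)

end Subdivide

end TwoComplex

/-! ### Geometric forms -/

/-- A geometric form: a finite connected 2-complex without isolated edges, with edge lengths in
`]0, 1]` such that every face boundary has length at most `1`. -/
structure GeometricForm where
  Y : TwoComplex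
  isConnected : Y.IsConnected
  noIsolatedEdges : Y.NoIsolatedEdges
  len : Y.E → ℝ
  len_pos : ∀ e, 0 < len e
  len_le_one : ∀ e, len e ≤ 1
  bdry_le_one : ∀ f, ((Y.bdry f).map fun a => len a.1).sum ≤ 1

/-- The sequence `(D ℓ)` is of the geometric form `Φ = (Y, λ)`: for large `ℓ`, `D ℓ` is obtained
from `Y` by dividing every edge `e` into `λ_e ℓ + o(ℓ)` edges of length `1`, such that every face
boundary has length at most `ℓ`. -/
def GeometricForm.IsForm (Φ : GeometricForm) (D : ℕ → TwoComplex) : Prop :=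
  ∃ n : ℕ → Φ.Y.E → ℕ+,
    (∀ e, Tendsto (fun ℓ : ℕ => ((n ℓ e : ℕ) : ℝ) / (ℓ : ℝ)) atTop (𝓝 (Φ.len e))) ∧
    ∀ᶠ ℓ in atTop, D ℓ = Φ.Y.subdivide (n ℓ) ∧ ∀ f, ((D ℓ).bdry f).length ≤ ℓ

/-- The sequence `(D ℓ)` consists of 2-complexes of the same geometric form. -/
def SameGeometricForm (D : ℕ → TwoComplex) : Prop := ∃ Φ : GeometricForm, Φ.IsForm D

/-! ### Van Kampen 2-complexes -/

/-- Words in the letters `x_1^±, …, x_m^±`. -/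
abbrev Word (m : ℕ) : Type := List (Fin m × Bool)

/-- A van Kampen 2-complex with respect to the presentation `⟨x_1, …, x_m | R⟩` whose underlying
2-complex is `Y`: compatible labels on the oriented edges by letters `x_i^±` and on the oriented
faces by relators or inverses of relators. -/
structure VanKampen (m : ℕ) (R : Set (Word m)) (Y : TwoComplex) where
  edgeLabel : Y.Dart → Fin m × Bool
  edgeLabel_inv : ∀ e b, edgeLabel (e, !b) = ((edgeLabel (e, b)).1, !(edgeLabel (e, b)).2)
  faceLabel : Y.F × Bool → Word m
  faceLabel_mem : ∀ f, faceLabel f ∈ R ∨ FreeGroup.invRev (faceLabel f) ∈ R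
  faceLabel_inv : ∀ f b, faceLabel (f, !b) = FreeGroup.invRev (faceLabel (f, b))
  compatible : ∀ f, (Y.orientedBdry f).map edgeLabel = faceLabel f

/-- No reducible pair of faces: no two different oriented faces have the same label and a common
oriented edge at the same position of their boundaries. -/
def VanKampen.IsReduced {m : ℕ} {R : Set (Word m)} {Y : TwoComplex} (W : VanKampen m R Y) : Prop :=
  ∀ f g : Y.F × Bool, f ≠ g → W.faceLabel f = W.faceLabel g →
    ∀ (j : ℕ) (a : Y.Dart), (Y.orientedBdry f)[j]? = some a → (Y.orientedBdry g)[j]? ≠ some a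

/-- `Y` is fillable by the presentation `⟨x_1, …, x_m | R⟩`: it is the underlying 2-complex of a
reduced van Kampen 2-complex. -/
def TwoComplex.Fillable (Y : TwoComplex) (m : ℕ) (R : Set (Word m)) : Prop :=
  ∃ W : VanKampen m R Y, W.IsReduced

/-! ### Random groups in the permutation invariant density model -/

/-- The set `B_ℓ` of cyclically reduced words of length at most `ℓ`. -/
abbrev B (m ℓ : ℕ) : Type := {w : Word m // FreeGroup.IsCyclicallyReduced w ∧ w.length ≤ ℓ}

instance (m ℓ : ℕ) : Finite (B m ℓ) :=
  ((List.finite_length_le (Fin m × Bool) ℓ).subset fun _ hw => hw.2).to_subtype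

/-- `R ℓ`, a random variable on the probability space `(Ω ℓ, P ℓ)`, is a random subset of `B_ℓ`;
the sequence is permutation invariant, and densable with density `d`. These are the random relators
of a sequence of random groups `G_ℓ(m, d) = ⟨x_1, …, x_m | R_ℓ⟩`. -/
structure IsRandomRelators (m : ℕ) (d : ℝ) {Ω : ℕ → Type*} [∀ ℓ, MeasurableSpace (Ω ℓ)]
    (P : ∀ ℓ, Measure (Ω ℓ)) (R : ∀ ℓ, Ω ℓ → Set (B m ℓ)) : Prop where
  /-- Each `R ℓ` is measurable (it takes finitely many values). -/
  measurable : ∀ ℓ S, MeasurableSet {ω | R ℓ ω = S}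
  /-- The law of `R ℓ` is invariant under the permutations of `B_ℓ`. -/
  invariant : ∀ ℓ (π : Equiv.Perm (B m ℓ)) S, P ℓ {ω | R ℓ ω = π '' S} = P ℓ {ω | R ℓ ω = S}
  /-- `log_{|B_ℓ|} |R_ℓ|` (which is `-∞` when `R_ℓ` is empty) converges in probability to `d`. -/
  densable : ∀ ε > 0, Tendsto (fun ℓ => P ℓ {ω | (R ℓ ω).Nonempty ∧
    |Real.logb (Nat.card (B m ℓ)) ((R ℓ ω).ncard) - d| ≤ ε}) atTop (𝓝 1)

end RandomGroups

/-!
The argument is a second moment computation. Fix `R ⊆ B_ℓ` of size `r`. By exchangeability, a tuple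
of `k` distinct words lies in `R` with probability about `(r / |B_ℓ|) ^ k`, so a family of tuples of
words contains one inside `R` with high probability as soon as, for every nonempty set `A` of
coordinates, few pairs of tuples in the family agree on `A`, compared with `(r / |B_ℓ|) ^ |A|`.

The tuples are the boundary words of labelings of `D_ℓ`. Every edge of `Y` is labelled by a reduced
word which starts and ends with a fixed code word and is free in between. In the plane the edges
around a vertex are cyclically ordered and only neighbouring ones meet at a corner of a face, so
three colours suffice to give the two edges at each corner different first letters; hence faces
carry cyclically reduced words. The code words tell the edges apart, so different oriented faces
carry different words. Prescribing the words on the faces of `A` prescribes the labels of the edges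
on these faces, so a proportion of about `(2m - 1) ^ (-E)` of the labelings has these words, `E`
being the number of edges of `D_ℓ` on the faces of `A`.

In a planar complex each geometric edge borders at most two faces, so the subcomplex `Z` spanned by
`A` satisfies `2 E = |Z| ℓ + |∂Z|`, and the hypothesis on `|∂Z|` says `E ≥ (1 - d + s / 2) |A| ℓ`.
Since `|B_ℓ| / r ≈ (2m - 1) ^ ((1 - d) ℓ)`, the number of pairs agreeing on `A` is negligible.
-/

namespace RandomGroups

section SecondMoment

/-- The probability that a uniformly random `r`-element subset of an `n`-element set contains a
given `j`-element subset. Only the range `j ≤ r ≤ n` is meaningful. -/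
noncomputable def inclusionProb (n r j : ℕ) : ℝ :=
  ∏ i ∈ Finset.range j, ((r : ℝ) - i) / (n - i)

theorem inclusionProb_nonneg {n r j : ℕ} (hrn : r ≤ n) (hj : j ≤ r) :
    0 ≤ inclusionProb n r j := by
  refine Finset.prod_nonneg fun i hi => ?_
  have hi : (i : ℝ) ≤ r := by exact_mod_cast (Finset.mem_range.1 hi).le.trans hj
  have hrn : (r : ℝ) ≤ n := by exact_mod_cast hrn
  exact div_nonneg (by linarith) (by linarith)

theorem choose_sub_eq_inclusionProb_mul {n r : ℕ} (hrn : r ≤ n) (j : ℕ) (hj : j ≤ r) :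
    ((n - j).choose (r - j) : ℝ) = inclusionProb n r j * n.choose r := by
  induction j with
  | zero => simp [inclusionProb]
  | succ j ih =>
    obtain ⟨r, rfl⟩ := Nat.exists_eq_add_of_le' hj
    obtain ⟨n, rfl⟩ := Nat.exists_eq_add_of_le' (hj.trans hrn)
    have pascal : ((n : ℝ) + 1) * n.choose r = (n + 1).choose (r + 1) * ((r : ℝ) + 1) := by
      exact_mod_cast Nat.add_one_mul_choose_eq n r
    have ih := ih (by omega)
    rw [show n + (j + 1) - j = n + 1 by omega, show r + (j + 1) - j = r + 1 by omega] at ih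
    rw [inclusionProb, Finset.prod_range_succ, ← inclusionProb, mul_right_comm, ← ih,
      Nat.add_sub_cancel, Nat.add_sub_cancel]
    push_cast
    rw [show (r : ℝ) + (j + 1) - j = r + 1 by ring, show (n : ℝ) + (j + 1) - j = n + 1 by ring,
      ← mul_div_assoc, ← pascal]
    field_simp

theorem inclusionProb_pos {n r j : ℕ} (hrn : r ≤ n) (hj : j ≤ r) : 0 < inclusionProb n r j := by
  refine (inclusionProb_nonneg hrn hj).lt_of_ne' fun h => ?_
  have hchoose := choose_sub_eq_inclusionProb_mul hrn j hj
  rw [h, zero_mul, Nat.cast_eq_zero] at hchoose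
  exact (Nat.choose_pos (by omega)).ne' hchoose

theorem inclusionProb_add_le {n r k t : ℕ} (hrn : r ≤ n) (h : k + t ≤ r) :
    inclusionProb n r (k + t) ≤ inclusionProb n r k * inclusionProb n r t := by
  rw [inclusionProb, Finset.prod_range_add]
  have hrn : (r : ℝ) ≤ n := by exact_mod_cast hrn
  have hlt (i : ℕ) (hi : i ∈ Finset.range t) : (k : ℝ) + i < r := by
    exact_mod_cast (Nat.add_lt_add_left (Finset.mem_range.1 hi) k).trans_le h
  refine mul_le_mul_of_nonneg_left (Finset.prod_le_prod (fun i hi => ?_) fun i hi => ?_)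
    (inclusionProb_nonneg (by exact_mod_cast hrn) (by omega)) <;>
  have := hlt i hi <;> push_cast
  · exact div_nonneg (by linarith) (by linarith)
  · rw [div_le_div_iff₀ (by linarith) (by linarith)]
    nlinarith [k.cast_nonneg (α := ℝ)]

theorem inclusionProb_le_mul_pow {n r j i : ℕ} (hrn : r ≤ n) (h : 2 * (j + i) ≤ r) :
    inclusionProb n r j ≤ inclusionProb n r (j + i) * (2 * n / r) ^ i := by
  induction i with
  | zero => simp
  | succ i ih =>
    have hfactor : 1 ≤ ((r : ℝ) - (j + i : ℕ)) / (n - (j + i : ℕ)) * (2 * n / r) := by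
      rw [← add_assoc] at h
      generalize j + i = x at h ⊢
      have hx : (2 : ℝ) * (x + 1) ≤ r := by exact_mod_cast h
      have hn : (r : ℝ) ≤ n := by exact_mod_cast hrn
      have hx0 := x.cast_nonneg (α := ℝ)
      rw [div_mul_div_comm, one_le_div (mul_pos (by linarith) (by linarith))]
      nlinarith [mul_nonneg (sub_nonneg.2 hx) (sub_nonneg.2 hn), mul_nonneg hx0 (sub_nonneg.2 hn)]
    calc inclusionProb n r j ≤ inclusionProb n r (j + i) * (2 * n / r) ^ i := ih (by omega)
      _ ≤ inclusionProb n r (j + i) * (2 * n / r) ^ i *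
          (((r : ℝ) - (j + i : ℕ)) / (n - (j + i : ℕ)) * (2 * n / r)) :=
        le_mul_of_one_le_right
          (mul_nonneg (inclusionProb_nonneg hrn (by omega)) (by positivity)) hfactor
      _ = inclusionProb n r (j + (i + 1)) * (2 * n / r) ^ (i + 1) := by
        rw [← add_assoc, inclusionProb, inclusionProb, Finset.prod_range_succ]
        ring

open Classical in
theorem card_filter_subset_powersetCard {β : Type*} [Fintype β] {r : ℕ} (hr : r ≤ Fintype.card β)
    (U : Finset β) (hU : U.card ≤ r) :
    ((((Finset.univ : Finset β).powersetCard r).filter (U ⊆ ·)).card : ℝ) =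
      inclusionProb (Fintype.card β) r U.card * (Fintype.card β).choose r := by
  rw [Finset.card_filter_powersetCard_subset U _ r U.subset_univ hU, Finset.card_univ,
    choose_sub_eq_inclusionProb_mul hr _ hU]

/-- The second moment method: Cauchy-Schwarz for the number of `x` such that `E x S` holds, over the
`S` for which there is such an `x`. -/
theorem card_filter_forall_not_le {α I : Type*} [Fintype I] (P : Finset α) (E : I → α → Prop)
    [∀ x, DecidablePred (E x)] {δ : ℝ} (hδ : 0 ≤ δ) (hpos : 0 < ∑ x, ((P.filter (E x)).card : ℝ))
    (h : P.card * ∑ x, ∑ y, ((P.filter fun S => E x S ∧ E y S).card : ℝ) ≤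
      (1 + δ) * (∑ x, ((P.filter (E x)).card : ℝ)) ^ 2) :
    ((P.filter fun S => ∀ x, ¬ E x S).card : ℝ) ≤ δ * P.card := by
  let X (S : α) : ℝ := ∑ x, if E x S then 1 else 0
  set G := P.filter fun S => ∃ x, E x S
  have hfilter (p : α → Prop) [DecidablePred p] (hp : ∀ S, p S → ∃ x, E x S) :
      ((P.filter p).card : ℝ) = ∑ S ∈ G, if p S then 1 else 0 := by
    rw [Finset.sum_boole, Finset.filter_filter]
    congr 2
    exact Finset.filter_congr fun S _ => (and_iff_right_of_imp (hp S)).symm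
  have first : ∑ x, ((P.filter (E x)).card : ℝ) = ∑ S ∈ G, X S := by
    rw [Finset.sum_comm (s := G)]
    exact Finset.sum_congr rfl fun x _ => hfilter (E x) fun _ h => ⟨x, h⟩
  have second : ∑ x, ∑ y, ((P.filter fun S => E x S ∧ E y S).card : ℝ) = ∑ S ∈ G, X S ^ 2 := by
    simp only [X, sq, Finset.sum_mul_sum, ite_zero_mul_ite_zero, mul_one]
    rw [Finset.sum_comm (s := G)]
    refine Finset.sum_congr rfl fun x _ => ?_
    rw [Finset.sum_comm (s := G)]
    exact Finset.sum_congr rfl fun y _ => hfilter _ fun _ h => ⟨x, h.1⟩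
  have cauchy : (∑ S ∈ G, X S) ^ 2 ≤ G.card * ∑ S ∈ G, X S ^ 2 := sq_sum_le_card_mul_sum_sq
  have hcompl : (G.card : ℝ) + (P.filter fun S => ∀ x, ¬ E x S).card = P.card := by
    simp only [G, ← not_exists]
    exact_mod_cast Finset.card_filter_add_card_filter_not _
  rw [first] at hpos h
  rw [second] at h
  have hX2 : 0 < ∑ S ∈ G, X S ^ 2 :=
    pos_of_mul_pos_right ((pow_pos hpos 2).trans_le cauchy) (Nat.cast_nonneg _)
  have hP : (P.card : ℝ) ≤ (1 + δ) * G.card := by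
    refine le_of_mul_le_mul_right (h.trans ?_) hX2
    rw [mul_assoc]
    exact mul_le_mul_of_nonneg_left cauchy (by linarith)
  have hG : (G.card : ℝ) ≤ P.card := by exact_mod_cast Finset.card_filter_le _ _
  linarith [mul_le_mul_of_nonneg_left hG hδ]

open Classical in
/-- The places where the tuple `v` meets the tuple `u`. -/
noncomputable def overlap {F β : Type*} [Fintype F] (u v : F → β) : Finset F :=
  Finset.univ.filter fun f => v f ∈ Set.range u

open Classical in
theorem card_image_union_image_add_card_overlap {F β : Type*} [Fintype F] {u v : F → β}
    (hu : Function.Injective u) (hv : Function.Injective v) :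
    (Finset.univ.image u ∪ Finset.univ.image v).card + (overlap u v).card =
      2 * Fintype.card F := by
  have hinter : Finset.univ.image u ∩ Finset.univ.image v = (overlap u v).image v := by
    ext b
    simp only [overlap, Finset.mem_inter, Finset.mem_image, Finset.mem_univ, true_and,
      Finset.mem_filter, Set.mem_range]
    constructor
    · rintro ⟨⟨f, rfl⟩, g, hg⟩
      exact ⟨g, ⟨f, hg.symm⟩, hg⟩
    · rintro ⟨g, ⟨f, hf⟩, rfl⟩
      exact ⟨⟨f, hf⟩, g, rfl⟩
  rw [← Finset.card_image_of_injective (overlap u v) hv, ← hinter,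
    Finset.card_union_add_card_inter, Finset.card_image_of_injective _ hu,
    Finset.card_image_of_injective _ hv, Finset.card_univ, two_mul]

open Classical in
theorem pow_card_overlap_le {F β : Type*} [Fintype F] (u v : F → β) {T : ℝ} (hT : 0 ≤ T) :
    T ^ (overlap u v).card ≤ 1 + ∑ A : Finset F with A.Nonempty, ∑ g : F → F,
      if ∀ f ∈ A, v f = u (g f) then T ^ A.card else 0 := by
  have hterm (A : Finset F) (g : F → F) :
      0 ≤ if ∀ f ∈ A, v f = u (g f) then T ^ A.card else 0 := by positivity
  have hsum (A : Finset F) := Finset.sum_nonneg fun g (_ : g ∈ Finset.univ) => hterm A g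
  rcases (overlap u v).eq_empty_or_nonempty with hempty | hne
  · rw [hempty, Finset.card_empty, pow_zero]
    exact le_add_of_nonneg_right (Finset.sum_nonneg fun A _ => hsum A)
  · have hmatch : ∀ f, ∃ f', f ∈ overlap u v → v f = u f' := fun f => by
      by_cases hf : f ∈ overlap u v
      · obtain ⟨f', hf'⟩ := (Finset.mem_filter.1 hf).2
        exact ⟨f', fun _ => hf'.symm⟩
      · exact ⟨f, fun h => absurd h hf⟩
    choose g hg using hmatch
    calc T ^ (overlap u v).card
        = if ∀ f ∈ overlap u v, v f = u (g f) then T ^ (overlap u v).card else 0 :=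
          (if_pos hg).symm
      _ ≤ _ := Finset.single_le_sum (fun g _ => hterm _ g) (Finset.mem_univ g)
      _ ≤ _ := Finset.single_le_sum (fun A _ => hsum A)
          (Finset.mem_filter.2 ⟨Finset.mem_univ _, hne⟩)
      _ ≤ _ := le_add_of_nonneg_left zero_le_one

open Classical in
theorem sum_pow_card_overlap_le {F β I : Type*} [Fintype F] [Fintype I] (w : I → F → β)
    (u : F → β) {T ε : ℝ} (hT : 0 ≤ T) (hε : 0 ≤ ε)
    (H : ∀ A : Finset F, A.Nonempty → ∀ v : F → β,
      ((Finset.univ.filter fun y => ∀ f ∈ A, w y f = v f).card : ℝ) * T ^ A.card ≤ ε) :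
    ∑ y, T ^ (overlap u (w y)).card ≤
      Fintype.card I + 2 ^ Fintype.card F * (Fintype.card F : ℝ) ^ Fintype.card F * ε := by
  have hcount (A : Finset F) (g : F → F) :
      ∑ y, (if ∀ f ∈ A, w y f = u (g f) then T ^ A.card else 0) =
        ((Finset.univ.filter fun y => ∀ f ∈ A, w y f = u (g f)).card : ℝ) * T ^ A.card := by
    rw [← Finset.sum_filter, Finset.sum_const, nsmul_eq_mul]
  calc ∑ y, T ^ (overlap u (w y)).card
      ≤ ∑ y, (1 + ∑ A : Finset F with A.Nonempty, ∑ g : F → F,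
          if ∀ f ∈ A, w y f = u (g f) then T ^ A.card else 0) :=
        Finset.sum_le_sum fun y _ => pow_card_overlap_le u (w y) hT
    _ = Fintype.card I + ∑ A : Finset F with A.Nonempty, ∑ g : F → F,
          ((Finset.univ.filter fun y => ∀ f ∈ A, w y f = u (g f)).card : ℝ) * T ^ A.card := by
        rw [Finset.sum_add_distrib, Finset.sum_comm]
        simp only [Finset.sum_comm (s := (Finset.univ : Finset I)), hcount]
        simp
    _ ≤ Fintype.card I + ∑ _A : Finset F, ∑ _g : F → F, ε := by
        rw [Finset.sum_filter]
        gcongr with A _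
        split_ifs with hA
        · exact Finset.sum_le_sum fun g _ => H A hA fun f => u (g f)
        · positivity
    _ = _ := by
        simp only [Finset.sum_const, Finset.card_univ, Fintype.card_finset, Fintype.card_fun,
          nsmul_eq_mul]
        push_cast
        ring

open Classical in
theorem card_filter_subset_and_subset_le {F β : Type*} [Fintype F] [Fintype β] {u v : F → β}
    (hu : Function.Injective u) (hv : Function.Injective v) {r : ℕ} (hr : 2 * Fintype.card F ≤ r)
    (hrn : r ≤ Fintype.card β) :
    ((((Finset.univ : Finset β).powersetCard r).filter fun S =>
      Finset.univ.image u ⊆ S ∧ Finset.univ.image v ⊆ S).card : ℝ) ≤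
      inclusionProb (Fintype.card β) r (Fintype.card F) ^ 2 *
        (2 * Fintype.card β / r) ^ (overlap u v).card * (Fintype.card β).choose r := by
  have hunion := card_image_union_image_add_card_overlap hu hv
  have hoverlap : (overlap u v).card ≤ Fintype.card F := Finset.card_le_univ _
  simp only [← Finset.union_subset_iff]
  rw [card_filter_subset_powersetCard hrn _ (by omega)]
  obtain ⟨j, hj⟩ := Nat.exists_eq_add_of_le' hoverlap
  rw [show (Finset.univ.image u ∪ Finset.univ.image v).card = Fintype.card F + j by omega]
  gcongr
  calc _ ≤ _ := inclusionProb_add_le hrn (by omega)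
    _ ≤ inclusionProb (Fintype.card β) r (Fintype.card F) *
        (inclusionProb (Fintype.card β) r (j + (overlap u v).card) *
          (2 * Fintype.card β / r) ^ (overlap u v).card) :=
      mul_le_mul_of_nonneg_left (inclusionProb_le_mul_pow hrn (by omega))
        (inclusionProb_nonneg hrn (by omega))
    _ = _ := by rw [← hj]; ring

open Classical in
theorem card_filter_powersetCard_le {β F I : Type*} [Fintype β] [Fintype F] [Fintype I]
    [Nonempty I] (w : I → F → β) (hw : ∀ x, Function.Injective (w x)) {r : ℕ}
    (hr : 2 * Fintype.card F ≤ r) (hrn : r ≤ Fintype.card β) {η : ℝ} (hη : 0 ≤ η)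
    (H : ∀ A : Finset F, A.Nonempty → ∀ v : F → β,
      ((Finset.univ.filter fun y => ∀ f ∈ A, w y f = v f).card : ℝ) *
        (2 * Fintype.card β / r) ^ A.card ≤ η * Fintype.card I) :
    ((((Finset.univ : Finset β).powersetCard r).filter fun S => ∀ x, ∃ f, w x f ∉ S).card : ℝ) ≤
      (2 ^ Fintype.card F * (Fintype.card F : ℝ) ^ Fintype.card F * η) *
        ((Fintype.card β).choose r : ℝ) := by
  let k := Fintype.card F
  let n := Fintype.card β
  let im (x : I) : Finset β := Finset.univ.image (w x)
  let P := (Finset.univ : Finset β).powersetCard r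
  have hP : (P.card : ℝ) = n.choose r := by rw [Finset.card_powersetCard, Finset.card_univ]
  have hone (x : I) : ((P.filter (im x ⊆ ·)).card : ℝ) = inclusionProb n r k * n.choose r := by
    have him : (im x).card = k := by
      rw [Finset.card_image_of_injective _ (hw x), Finset.card_univ]
    rw [card_filter_subset_powersetCard hrn _ (by omega), him]
  have htwo (x : I) : ∑ y, ((P.filter fun S => im x ⊆ S ∧ im y ⊆ S).card : ℝ) ≤
      inclusionProb n r k ^ 2 * n.choose r *
        (Fintype.card I + 2 ^ k * (k : ℝ) ^ k * (η * Fintype.card I)) := by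
    calc _ ≤ ∑ y, inclusionProb n r k ^ 2 * n.choose r *
          (2 * n / r : ℝ) ^ (overlap (w x) (w y)).card := by
          refine Finset.sum_le_sum fun y _ => ?_
          rw [mul_right_comm]
          exact card_filter_subset_and_subset_le (hw x) (hw y) hr hrn
      _ ≤ _ := by
          rw [← Finset.mul_sum]
          gcongr
          exact sum_pow_card_overlap_le w (w x) (by positivity) (by positivity) H
  have hbad : (P.filter fun S => ∀ x, ∃ f, w x f ∉ S) = P.filter fun S => ∀ x, ¬ im x ⊆ S :=
    Finset.filter_congr fun S _ => by simp [im, Finset.image_subset_iff]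
  have hchoose : 0 < (n.choose r : ℝ) := by exact_mod_cast Nat.choose_pos hrn
  have hincl : 0 < inclusionProb n r k := inclusionProb_pos hrn (by omega)
  rw [hbad, ← hP]
  refine card_filter_forall_not_le P (fun x S => im x ⊆ S) (by positivity) ?_ ?_
  · simp only [hone]
    exact Finset.sum_pos (fun x _ => mul_pos hincl hchoose) Finset.univ_nonempty
  · simp only [hone]
    grw [Finset.sum_le_sum fun x _ => htwo x]
    simp only [Finset.sum_const, Finset.card_univ, nsmul_eq_mul]
    rw [hP]
    exact le_of_eq (by ring)

end SecondMoment

section Exchangeable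

open scoped Pointwise in
theorem exists_perm_image_eq {β : Type*} {S T : Finset β} (h : S.card = T.card) :
    ∃ π : Equiv.Perm β, π '' (S : Set β) = T := by
  classical
  obtain ⟨π, hπ⟩ := (Set.powersetCard.isPretransitive (α := β) (n := T.card)).exists_smul_eq
    ⟨S, h⟩ ⟨T, rfl⟩
  refine ⟨π, ?_⟩
  have hπ : π • S = T := congrArg Subtype.val hπ
  rw [← hπ]
  exact (Finset.coe_smul_finset π S).symm

variable {β Ω : Type*} [MeasurableSpace Ω] {P : Measure Ω} {R : Ω → Set β}

theorem sum_measureReal_eq_coe [IsFiniteMeasure P] (hmeas : ∀ S, MeasurableSet {ω | R ω = S})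
    (s : Finset (Finset β)) :
    ∑ S ∈ s, P.real {ω | R ω = S} = P.real {ω | ∃ S ∈ s, R ω = S} := by
  have hdisj : (s : Set (Finset β)).PairwiseDisjoint fun S => {ω | R ω = S} :=
    fun S _ T _ hST => Set.disjoint_left.2 fun ω hS hT =>
      hST (Finset.coe_injective (Eq.trans (Eq.symm hS) hT))
  rw [← measureReal_biUnion_finset hdisj fun S _ => hmeas S]
  congr 1
  ext ω
  simp

open Classical in
theorem measureReal_ncard_eq_and_le [Fintype β] [IsFiniteMeasure P]
    (hmeas : ∀ S, MeasurableSet {ω | R ω = S})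
    (hinv : ∀ (π : Equiv.Perm β) S, P {ω | R ω = π '' S} = P {ω | R ω = S})
    (bad : Set β → Prop) {r : ℕ} {δ : ℝ}
    (H : ((((Finset.univ : Finset β).powersetCard r).filter fun S : Finset β => bad S).card : ℝ) ≤
      δ * (Fintype.card β).choose r) :
    P.real {ω | (R ω).ncard = r ∧ bad (R ω)} ≤ δ * P.real {ω | (R ω).ncard = r} := by
  let sets := (Finset.univ : Finset β).powersetCard r
  have hset (s : Finset (Finset β)) (p : Set β → Prop) (hs : ∀ S : Finset β, S ∈ s ↔ p S) :
      P.real {ω | p (R ω)} = ∑ S ∈ s, P.real {ω | R ω = S} := by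
    rw [sum_measureReal_eq_coe hmeas]
    congr 1
    ext ω
    constructor
    · exact fun h => ⟨(R ω).toFinset, (hs _).2 (by simpa using h), by simp⟩
    · rintro ⟨S, hS, hRS⟩
      exact (congrArg p hRS).mpr ((hs S).1 hS)
  obtain ⟨c, hc0, hc⟩ : ∃ c, 0 ≤ c ∧ ∀ S ∈ sets, P.real {ω | R ω = S} = c := by
    rcases sets.eq_empty_or_nonempty with hempty | ⟨T, hT⟩
    · exact ⟨0, le_rfl, by simp [hempty]⟩
    · refine ⟨P.real {ω | R ω = T}, measureReal_nonneg, fun S hS => ?_⟩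
      obtain ⟨π, hπ⟩ := exists_perm_image_eq
        ((Finset.mem_powersetCard.1 hT).2.trans (Finset.mem_powersetCard.1 hS).2.symm)
      rw [← hπ, measureReal_def, hinv, ← measureReal_def]
  rw [hset (sets.filter fun S : Finset β => bad S) (fun S => S.ncard = r ∧ bad S) (by simp [sets]),
    hset sets (fun S => S.ncard = r) (by simp [sets]),
    Finset.sum_congr rfl fun S hS => hc S (Finset.mem_of_mem_filter S hS),
    Finset.sum_congr rfl hc, Finset.sum_const, Finset.sum_const, nsmul_eq_mul, nsmul_eq_mul,
    Finset.card_powersetCard, Finset.card_univ, ← mul_assoc]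
  exact mul_le_mul_of_nonneg_right H hc0

theorem measurableSet_setOf_of_finite [Finite β] (hmeas : ∀ S, MeasurableSet {ω | R ω = S})
    (p : Set β → Prop) : MeasurableSet {ω | p (R ω)} := by
  have hunion : {ω | p (R ω)} = ⋃ S ∈ {S | p S}, {ω | R ω = S} := by
    ext ω
    simp
  rw [hunion]
  exact MeasurableSet.biUnion (Set.to_countable _) fun S _ => hmeas S

theorem measureReal_forall_exists_notMem_le [Fintype β] [IsProbabilityMeasure P]
    (hmeas : ∀ S, MeasurableSet {ω | R ω = S})
    (hinv : ∀ (π : Equiv.Perm β) S, P {ω | R ω = π '' S} = P {ω | R ω = S})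
    {F I : Type*} [Fintype F] [Fintype I] [Nonempty I] (w : I → F → β)
    (hw : ∀ x, Function.Injective (w x)) {r₀ : ℝ} (hpos : 0 < r₀)
    (hr₀ : 2 * Fintype.card F ≤ r₀) {η : ℝ} (hη : 0 ≤ η)
    (H : ∀ A : Finset F, A.Nonempty → ∀ v : F → β,
      ({y | ∀ f ∈ A, w y f = v f}.ncard : ℝ) * (2 * Fintype.card β / r₀) ^ A.card ≤
        η * Fintype.card I) :
    P.real {ω | r₀ ≤ (R ω).ncard ∧ ∀ x, ∃ f, w x f ∉ R ω} ≤
      2 ^ Fintype.card F * (Fintype.card F : ℝ) ^ Fintype.card F * η := by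
  classical
  set δ := 2 ^ Fintype.card F * (Fintype.card F : ℝ) ^ Fintype.card F * η
  let bad (S : Set β) : Prop := ∀ x, ∃ f, w x f ∉ S
  let sizes := (Finset.range (Fintype.card β + 1)).filter fun r : ℕ => r₀ ≤ r
  have hsize (r : ℕ) (hr : r ∈ sizes) :
      P.real {ω | (R ω).ncard = r ∧ bad (R ω)} ≤ δ * P.real {ω | (R ω).ncard = r} := by
    obtain ⟨hrn, hr⟩ := Finset.mem_filter.1 hr
    have H' (A : Finset F) (hA : A.Nonempty) (v : F → β) :
        ((Finset.univ.filter fun y => ∀ f ∈ A, w y f = v f).card : ℝ) *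
          (2 * Fintype.card β / r) ^ A.card ≤ η * Fintype.card I := by
      refine le_trans ?_ (H A hA v)
      rw [Set.ncard_eq_toFinset_card', Set.toFinset_ofPred]
      gcongr
    refine measureReal_ncard_eq_and_le hmeas hinv bad ?_
    convert card_filter_powersetCard_le w hw (by exact_mod_cast hr₀.trans hr)
      (Nat.lt_succ_iff.1 (Finset.mem_range.1 hrn)) hη H'
    exact Finset.mem_coe
  calc P.real {ω | r₀ ≤ (R ω).ncard ∧ bad (R ω)}
      ≤ P.real (⋃ r ∈ sizes, {ω | (R ω).ncard = r ∧ bad (R ω)}) := by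
        refine measureReal_mono (fun ω hω => ?_) (measure_ne_top P _)
        simp only [sizes, Set.mem_iUnion]
        refine ⟨(R ω).ncard, Finset.mem_filter.2 ⟨Finset.mem_range.2 ?_, hω.1⟩, rfl, hω.2⟩
        exact Nat.lt_succ_of_le ((Set.ncard_le_card _).trans_eq Nat.card_eq_fintype_card)
    _ ≤ ∑ r ∈ sizes, P.real {ω | (R ω).ncard = r ∧ bad (R ω)} := measureReal_biUnion_finset_le _ _
    _ ≤ ∑ r ∈ sizes, δ * P.real {ω | (R ω).ncard = r} := Finset.sum_le_sum hsize
    _ = δ * P.real ((fun ω => (R ω).ncard) ⁻¹' sizes) := by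
        rw [← Finset.mul_sum, ← sum_measureReal_preimage_singleton sizes fun r _ =>
          measurableSet_setOf_of_finite hmeas fun S => S.ncard = r]
        rfl
    _ ≤ δ := mul_le_of_le_one_right (by positivity) measureReal_le_one

end Exchangeable

section Words

variable {m : ℕ}

theorem card_isChain_cons_of_card_eq {α : Type*} [Finite α] {r : α → α → Prop} {k : ℕ}
    (hr : ∀ a, Nat.card {b // r a b} = k) (L : ℕ) (a : α) :
    Nat.card {w : List α // w.length = L ∧ (a :: w).IsChain r} = k ^ L := by
  induction L generalizing a with
  | zero =>
    have : Unique {w : List α // w.length = 0 ∧ (a :: w).IsChain r} :=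
      { default := ⟨[], rfl, .singleton a⟩
        uniq := fun w => Subtype.ext (List.length_eq_zero_iff.1 w.2.1) }
    rw [Nat.card_unique, pow_zero]
  | succ L ih =>
    let e : (Σ b : {b // r a b}, {w : List α // w.length = L ∧ (b.1 :: w).IsChain r}) ≃
        {w : List α // w.length = L + 1 ∧ (a :: w).IsChain r} :=
      { toFun := fun p => ⟨p.1.1 :: p.2.1, by simp [p.2.2.1], .cons_cons p.1.2 p.2.2.2⟩
        invFun := fun
          | ⟨b :: w, hw⟩ => ⟨⟨b, (List.isChain_cons_cons.1 hw.2).1⟩, w, Nat.succ.inj hw.1,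
              (List.isChain_cons_cons.1 hw.2).2⟩
        left_inv := fun _ => rfl
        right_inv := fun
          | ⟨_ :: _, _⟩ => rfl }
    have (b : α) : Finite {w : List α // w.length = L ∧ (b :: w).IsChain r} :=
      ((List.finite_length_eq α L).subset fun _ hw => hw.1).to_subtype
    cases nonempty_fintype {b // r a b}
    rw [← Nat.card_congr e, Nat.card_sigma, Finset.sum_congr rfl fun b _ => ih b.1,
      Finset.sum_const, Finset.card_univ, ← Nat.card_eq_fintype_card, hr, smul_eq_mul, pow_succ']

theorem card_letters_not_cancelling (x : Fin m × Bool) :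
    Nat.card {y : Fin m × Bool // x.1 = y.1 → x.2 = y.2} = 2 * m - 1 := by
  have hset (y : Fin m × Bool) : (x.1 = y.1 → x.2 = y.2) ↔ y ≠ (x.1, !x.2) := by
    rw [Ne, Prod.ext_iff, Bool.eq_not, not_and, not_not, eq_comm (a := y.1), eq_comm (a := y.2)]
  simp_rw [hset]
  rw [Nat.card_eq_fintype_card, Fintype.card_subtype_compl, Fintype.card_subtype_eq,
    Fintype.card_prod, Fintype.card_fin, Fintype.card_bool, mul_comm]

theorem card_isReduced_cons (L : ℕ) (s : Fin m × Bool) :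
    Nat.card {w : Word m // w.length = L ∧ FreeGroup.IsReduced (s :: w)} = (2 * m - 1) ^ L :=
  card_isChain_cons_of_card_eq card_letters_not_cancelling L s

instance finite_isReduced_length (n : ℕ) :
    Finite {w : Word m // w.length = n ∧ FreeGroup.IsReduced w} :=
  ((List.finite_length_eq (Fin m × Bool) n).subset fun _ hw => hw.1).to_subtype

theorem card_isReduced_le (hm : 0 < m) (n : ℕ) :
    Nat.card {w : Word m // w.length = n ∧ FreeGroup.IsReduced w} ≤ 2 * (2 * m - 1) ^ n := by
  let s (b : Bool) : Fin m × Bool := (⟨0, hm⟩, b)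
  have hcover : {w : Word m | w.length = n ∧ FreeGroup.IsReduced w} ⊆
      {w | w.length = n ∧ FreeGroup.IsReduced (s true :: w)} ∪
        {w | w.length = n ∧ FreeGroup.IsReduced (s false :: w)} := by
    rintro (_ | ⟨⟨i, b⟩, w⟩) ⟨hlen, hw⟩
    · exact .inl ⟨hlen, .singleton⟩
    · cases b
      · exact .inr ⟨hlen, .cons_cons (fun _ => rfl) hw⟩
      · exact .inl ⟨hlen, .cons_cons (fun _ => rfl) hw⟩
  have hfin : ({w : Word m | w.length = n}).Finite := List.finite_length_eq _ n
  calc _ ≤ _ := Set.ncard_le_ncard hcover (hfin.subset <| by rintro w (hw | hw) <;> exact hw.1)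
    _ ≤ _ := Set.ncard_union_le _ _
    _ = 2 * (2 * m - 1) ^ n := by
        rw [two_mul]
        exact congrArg₂ _ (card_isReduced_cons n _) (card_isReduced_cons n _)

theorem card_B_le (hm : 2 ≤ m) (ℓ : ℕ) : Nat.card (B m ℓ) ≤ 4 * (2 * m - 1) ^ ℓ := by
  let φ (w : B m ℓ) :
      Σ j : Fin (ℓ + 1), {w : Word m // w.length = j ∧ FreeGroup.IsReduced w} :=
    ⟨⟨w.1.length, Nat.lt_succ_of_le w.2.2⟩, w.1, rfl, w.2.1.1⟩
  have hφ : Function.Injective φ := fun v w h =>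
    Subtype.ext (congrArg (fun p : Σ j : Fin (ℓ + 1), _ => p.2.1) h)
  calc Nat.card (B m ℓ) ≤ _ := Nat.card_le_card_of_injective φ hφ
    _ = ∑ j : Fin (ℓ + 1), Nat.card {w : Word m // w.length = j ∧ FreeGroup.IsReduced w} :=
        Nat.card_sigma
    _ ≤ ∑ j : Fin (ℓ + 1), 2 * (2 * m - 1) ^ (j : ℕ) :=
        Finset.sum_le_sum fun j _ => card_isReduced_le (by lia) _
    _ = 2 * (∑ j ∈ Finset.range ℓ, (2 * m - 1) ^ j + (2 * m - 1) ^ ℓ) := by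
        rw [← Finset.mul_sum, Fin.sum_univ_eq_sum_range (fun j => (2 * m - 1) ^ j),
          Finset.sum_range_succ]
    _ ≤ 4 * (2 * m - 1) ^ ℓ := by
        have : ∑ j ∈ Finset.range ℓ, (2 * m - 1) ^ j < (2 * m - 1) ^ ℓ :=
          Nat.geomSum_lt (by lia) fun j hj => Finset.mem_range.1 hj
        lia

theorem lt_card_B (hm : 0 < m) (ℓ : ℕ) : ℓ < Nat.card (B m ℓ) := by
  let x : Fin m × Bool := (⟨0, hm⟩, true)
  have hred (j : ℕ) : FreeGroup.IsCyclicallyReduced (List.replicate j x) := by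
    refine ⟨List.isChain_replicate_of_rel _ fun _ => rfl, fun a ha b hb _ => ?_⟩
    rw [List.eq_of_mem_replicate (List.mem_of_mem_getLast? ha),
      List.eq_of_mem_replicate (List.mem_of_mem_head? hb)]
  let power (j : Fin (ℓ + 1)) : B m ℓ :=
    ⟨List.replicate j x, hred j, (List.length_replicate ..).trans_le (Nat.lt_succ_iff.1 j.2)⟩
  have hpower : Function.Injective power := fun i j h =>
    Fin.ext (List.replicate_left_injective x (congrArg Subtype.val h))
  simpa [Nat.succ_le_iff] using Nat.card_le_card_of_injective power hpower

theorem isReduced_invRev {w : Word m} (h : FreeGroup.IsReduced w) :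
    FreeGroup.IsReduced (FreeGroup.invRev w) := by
  rw [FreeGroup.isReduced_iff_reduce_eq] at h ⊢
  rw [FreeGroup.reduce_invRev, h]

theorem le_card_isReduced_between (hm : 2 ≤ m) (L : ℕ) (s t : Fin m × Bool) :
    (2 * m - 1) ^ L ≤
      Nat.card {w : Word m // w.length = L + 1 ∧ FreeGroup.IsReduced (s :: w ++ [t])} := by
  have : Nontrivial (Fin m) := Fin.nontrivial_iff_two_le.2 hm
  choose z hz using fun x : Fin m × Bool => exists_ne x.1
  let y (u : Word m) : Fin m × Bool := (z ((s :: u).getLast (List.cons_ne_nil s u)), t.2)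
  have hy (u : Word m) (hu : FreeGroup.IsReduced (s :: u)) :
      FreeGroup.IsReduced (s :: (u ++ [y u]) ++ [t]) := by
    rw [← List.cons_append, List.append_assoc]
    refine List.isChain_append.2 ⟨hu, .cons_cons (fun _ => rfl) (.singleton t), ?_⟩
    intro x hx x' hx' h
    rw [List.getLast?_eq_getLast_of_ne_nil (List.cons_ne_nil s u), Option.mem_some_iff] at hx
    rw [List.singleton_append, List.head?_cons, Option.mem_some_iff] at hx'
    subst hx hx'
    exact absurd h.symm (hz _)
  let extend (u : {w : Word m // w.length = L ∧ FreeGroup.IsReduced (s :: w)}) :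
      {w : Word m // w.length = L + 1 ∧ FreeGroup.IsReduced (s :: w ++ [t])} :=
    ⟨u.1 ++ [y u.1], by simp [u.2.1], hy u.1 u.2.2⟩
  have hextend : Function.Injective extend := fun u v h =>
    Subtype.ext (List.append_inj_left' (congrArg Subtype.val h) rfl)
  have : Finite {w : Word m // w.length = L + 1 ∧ FreeGroup.IsReduced (s :: w ++ [t])} :=
    ((List.finite_length_eq (Fin m × Bool) (L + 1)).subset fun _ hw => hw.1).to_subtype
  rw [← card_isReduced_cons L s]
  exact Nat.card_le_card_of_injective extend hextend

/-- The reduced words of length `n` that begin with `c` and whose inverses begin with `c'`: the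
words that may label the subdivision of an edge whose two ends are marked by `c` and `c'`. -/
def edgeWords (m n : ℕ) (c c' : Word m) : Set (Word m) :=
  {u | u.length = n ∧ FreeGroup.IsReduced u ∧ c <+: u ∧ c' <+: FreeGroup.invRev u}

instance finite_edgeWords (n : ℕ) (c c' : Word m) : Finite (edgeWords m n c c') :=
  ((List.finite_length_eq (Fin m × Bool) n).subset fun _ hw => hw.1).to_subtype

theorem append_mem_edgeWords {c₀ t₀ u : Word m} {s t : Fin m × Bool}
    (hs : FreeGroup.IsReduced (c₀ ++ [s])) (hu : FreeGroup.IsReduced (s :: u ++ [t]))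
    (ht : FreeGroup.IsReduced (t :: t₀)) :
    c₀ ++ [s] ++ (u ++ t :: t₀) ∈
      edgeWords m (c₀.length + u.length + t₀.length + 2) (c₀ ++ [s])
        (FreeGroup.invRev (t :: t₀)) := by
  refine ⟨by simp; lia, ?_, List.prefix_append _ _, ?_⟩
  · have hut : FreeGroup.IsReduced ([s] ++ (u ++ t :: t₀)) := by
      simpa using FreeGroup.IsReduced.append_overlap (L₁ := s :: u) (L₂ := [t]) (L₃ := t₀) hu ht
        (List.cons_ne_nil _ _)
    exact FreeGroup.IsReduced.append_overlap hs hut (List.cons_ne_nil _ _)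
  · rw [FreeGroup.invRev_append, FreeGroup.invRev_append, List.append_assoc]
    exact List.prefix_append _ _

theorem le_card_edgeWords (hm : 2 ≤ m) {n q : ℕ} {c c' : Word m} (hc : FreeGroup.IsReduced c)
    (hc' : FreeGroup.IsReduced c') (hq : c.length = q) (hq' : c'.length = q) (hq0 : 0 < q)
    (hn : 2 * q + 1 ≤ n) : (2 * m - 1) ^ (n - (2 * q + 1)) ≤ Nat.card (edgeWords m n c c') := by
  obtain ⟨c₀, s, rfl⟩ := List.eq_nil_or_concat' c |>.resolve_left (by rintro rfl; simp_all)
  obtain ⟨t, t₀, ht⟩ := List.exists_cons_of_ne_nil (l := FreeGroup.invRev c')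
    (List.ne_nil_of_length_pos (by rwa [FreeGroup.invRev_length, hq']))
  have hlen : c₀.length + (n - (2 * q + 1) + 1) + t₀.length + 2 = n := by
    have ht₀ := congrArg List.length ht
    rw [FreeGroup.invRev_length, List.length_cons] at ht₀
    rw [List.length_append, List.length_singleton] at hq
    lia
  have hc'' : c' = FreeGroup.invRev (t :: t₀) := by rw [← ht, FreeGroup.invRev_invRev]
  have hred : FreeGroup.IsReduced (t :: t₀) := ht ▸ isReduced_invRev hc'
  let between := {u : Word m // u.length = n - (2 * q + 1) + 1 ∧
    FreeGroup.IsReduced (s :: u ++ [t])}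
  let φ (u : between) : edgeWords m n (c₀ ++ [s]) c' := ⟨c₀ ++ [s] ++ (u.1 ++ t :: t₀), by
    have hmem := append_mem_edgeWords hc u.2.2 hred
    rwa [u.2.1, hlen, ← hc''] at hmem⟩
  refine (le_card_isReduced_between hm _ s t).trans (Nat.card_le_card_of_injective φ ?_)
  exact fun u v h => Subtype.ext
    (List.append_cancel_right (List.append_cancel_left (congrArg Subtype.val h)))

theorem exists_injective_isReduced_head (hm : 2 ≤ m) {δ : Type*} [Finite δ]
    (col : δ → Fin m × Bool) :
    ∃ q : ℕ, 0 < q ∧ ∃ c : δ → Word m, Function.Injective c ∧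
      ∀ a, (c a).length = q ∧ FreeGroup.IsReduced (c a) ∧ (c a).head? = some (col a) := by
  obtain ⟨N, ⟨e⟩⟩ := Finite.exists_equiv_fin δ
  have : Nontrivial (Fin m) := Fin.nontrivial_iff_two_le.2 hm
  choose z hz using fun x : Fin m × Bool => exists_ne x.1
  have hne (x : Fin m × Bool) : (z x, true) ≠ x := fun h => hz x (congrArg Prod.fst h)
  refine ⟨N + 1, Nat.succ_pos _, fun a => List.replicate (e a + 1) (col a) ++
    List.replicate (N - e a) (z (col a), true), fun a b h => ?_, fun a => ⟨?_, ?_, ?_⟩⟩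
  · have hcol : col a = col b := by simpa [List.replicate_succ] using congrArg List.head? h
    simpa [List.count_replicate, ← hcol, hne, Fin.val_inj] using congrArg (List.count (col a)) h
  · simp only [List.length_append, List.length_replicate]
    lia
  · refine List.isChain_append.2 ⟨List.isChain_replicate_of_rel _ fun _ => rfl,
      List.isChain_replicate_of_rel _ fun _ => rfl, fun x hx y hy h => absurd h.symm ?_⟩
    rw [List.eq_of_mem_replicate (List.mem_of_mem_getLast? hx),
      List.eq_of_mem_replicate (List.mem_of_mem_head? hy)]
    exact hz _
  · simp [List.replicate_succ]

end Words

section Planar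

theorem mem_invRev {α : Type*} {l : List (α × Bool)} {a : α × Bool} :
    a ∈ FreeGroup.invRev l ↔ (a.1, !a.2) ∈ l := by
  simp only [FreeGroup.invRev, List.mem_reverse, List.mem_map]
  constructor
  · rintro ⟨x, hx, rfl⟩
    simpa using hx
  · exact fun h => ⟨_, h, by simp⟩

theorem cycleChain_and {α : Type*} {r s : α → α → Prop} {l : List α}
    (hr : Cycle.Chain r (l : Cycle α)) (hs : Cycle.Chain s (l : Cycle α)) :
    Cycle.Chain (fun a b => r a b ∧ s a b) (l : Cycle α) := by
  obtain _ | ⟨a, t⟩ := l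
  · exact Cycle.Chain.nil _
  rw [Cycle.chain_coe_cons, List.isChain_iff_forall_rel_of_append_cons_cons] at *
  exact fun a b l₁ l₂ h => ⟨hr h, hs h⟩

theorem cycleChain_invRev {α : Type*} {r : α × Bool → α × Bool → Prop}
    (hr : ∀ a b, r a b → r (b.1, !b.2) (a.1, !a.2)) {l : List (α × Bool)}
    (h : Cycle.Chain r (l : Cycle (α × Bool))) :
    Cycle.Chain r (FreeGroup.invRev l : Cycle (α × Bool)) := by
  obtain _ | ⟨a, t⟩ := l
  · exact Cycle.Chain.nil _
  have hrot : ((FreeGroup.invRev (a :: t) : List (α × Bool)) : Cycle (α × Bool)) =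
      (((a.1, !a.2) :: FreeGroup.invRev t : List (α × Bool)) : Cycle (α × Bool)) := by
    rw [FreeGroup.invRev_cons]
    exact Cycle.coe_eq_coe.2 List.isRotated_append
  have hrev : (a.1, !a.2) :: (FreeGroup.invRev t ++ [(a.1, !a.2)]) =
      ((a :: (t ++ [a])).map fun x => (x.1, !x.2)).reverse := by
    simp [FreeGroup.invRev]
  rw [hrot, Cycle.chain_coe_cons, hrev, List.isChain_reverse, List.isChain_map]
  exact ((Cycle.chain_coe_cons _ _ _).1 h).imp hr

theorem cycleChain_exists_next {α : Type*} {r : α → α → Prop} {l : List α}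
    (h : Cycle.Chain r (l : Cycle α)) {a : α} (ha : a ∈ l) : ∃ b ∈ l, r a b := by
  obtain ⟨p, q, rfl⟩ := List.append_of_mem ha
  have hrot : ((p ++ a :: q : List α) : Cycle α) = ((a :: (q ++ p) : List α) : Cycle α) :=
    Cycle.coe_eq_coe.2 List.isRotated_append
  rw [hrot, Cycle.chain_coe_cons] at h
  obtain ⟨b, l, hl⟩ := List.exists_cons_of_ne_nil (l := q ++ p ++ [a]) (by simp)
  rw [hl, List.isChain_cons_cons] at h
  have hb : b ∈ q ++ p ++ [a] := hl ▸ List.mem_cons_self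
  simp only [List.mem_append, List.mem_singleton] at hb
  exact ⟨b, by grind, h.1⟩

theorem exists_coloring_perm {α κ : Type*} [Finite α] [Finite κ] (hκ : 3 ≤ Nat.card κ)
    (σ : Equiv.Perm α) : ∃ col : α → κ, ∀ x, σ x ≠ x → col x ≠ col (σ x) := by
  classical
  cases nonempty_fintype α
  cases nonempty_fintype κ
  have : Nonempty κ := (Nat.card_pos_iff.1 (by lia)).1
  suffices h : ∀ s : Finset α, ∃ col : α → κ, ∀ x ∈ s, σ x ∈ s → σ x ≠ x → col x ≠ col (σ x) by
    obtain ⟨col, h⟩ := h Finset.univ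
    exact ⟨col, fun x => h x (Finset.mem_univ _) (Finset.mem_univ _)⟩
  intro s
  induction s using Finset.induction_on with
  | empty => exact ⟨fun _ => Classical.arbitrary κ, by simp⟩
  | insert a s ha ih =>
    obtain ⟨col, hcol⟩ := ih
    obtain ⟨z, hz⟩ : ∃ z, z ∉ ({col (σ a), col (σ.symm a)} : Finset κ) :=
      Finset.exists_mem_notMem_of_card_lt_card (s := {col (σ a), col (σ.symm a)})
        (t := Finset.univ) (Finset.card_le_two.trans_lt <| by
          rwa [Finset.card_univ, ← Nat.card_eq_fintype_card]) |>.imp fun _ => And.right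
    simp only [Finset.mem_insert, Finset.mem_singleton, not_or] at hz
    refine ⟨Function.update col a z, fun x hx hσx hne => ?_⟩
    rcases eq_or_ne x a with rfl | hxa
    · rw [Function.update_self, Function.update_of_ne hne]
      exact hz.1
    rcases eq_or_ne (σ x) a with rfl | hσ
    · rw [Function.update_of_ne hxa, Function.update_self]
      exact fun h => hz.2 (by rw [Equiv.symm_apply_apply, h])
    · rw [Function.update_of_ne hxa, Function.update_of_ne hσ]
      exact hcol x (Finset.mem_of_mem_insert_of_ne hx hxa)
        (Finset.mem_of_mem_insert_of_ne hσx hσ) hne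

namespace FinGraph

variable {G : FinGraph}

instance finite_dart (G : FinGraph) : Finite G.Dart := inferInstanceAs (Finite (G.E × Bool))

theorem flip_flip (a : G.Dart) : G.flip (G.flip a) = a := by simp [flip]

theorem init_flip (a : G.Dart) : G.init (G.flip a) = G.term a := by
  obtain ⟨e, _ | _⟩ := a <;> rfl

theorem trace_flip (σ : Equiv.Perm G.Dart) (a : G.Dart) : G.trace σ (G.flip a) = σ a := by
  rw [trace, Equiv.Perm.mul_apply, flip_flip]

theorem Follows.ne_flip {a b : G.Dart} (h : G.Follows a b) : b ≠ G.flip a := by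
  rintro rfl
  simpa [flip] using h.2 rfl

theorem IsRotation.mem_of_component_eq {σ : Equiv.Perm G.Dart} (hσ : G.IsRotation σ)
    {T : Set G.Dart} (hflip : ∀ a ∈ T, G.flip a ∈ T) (htrace : ∀ a ∈ T, G.trace σ a ∈ T)
    {a b : G.Dart} (ha : a ∈ T) (hab : G.component (G.init a) = G.component (G.init b)) :
    b ∈ T := by
  have hpow (i : ℕ) : ∀ x ∈ T, (σ ^ i) x ∈ T := by
    induction i with
    | zero => exact fun _ hx => hx
    | succ i ih =>
      intro x hx
      rw [pow_succ', Equiv.Perm.mul_apply, ← trace_flip]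
      exact htrace _ (hflip _ (ih x hx))
  have hinit (x : G.Dart) : (∃ y ∈ T, G.init y = G.init x) ↔ x ∈ T := by
    refine ⟨fun ⟨y, hy, hyx⟩ => ?_, fun hx => ⟨x, hx, rfl⟩⟩
    obtain ⟨i, rfl⟩ := ((hσ y x).2 hyx).exists_nat_pow_eq
    exact hpow i y hy
  have hadj (x : G.Dart) :
      (∃ y ∈ T, G.init y = G.init x) ↔ ∃ y ∈ T, G.init y = G.term x := by
    rw [← init_flip, hinit, hinit]
    exact ⟨hflip x, fun hx => flip_flip x ▸ hflip _ hx⟩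
  have hcomp (v w : G.V) (h : G.component v = G.component w) :
      (∃ y ∈ T, G.init y = v) ↔ ∃ y ∈ T, G.init y = w := by
    induction Quot.eqvGen_exact h with
    | rel _ _ hvw =>
      obtain ⟨x, rfl, rfl⟩ := hvw
      exact hadj x
    | refl => rfl
    | symm _ _ _ ih => exact (ih (Quot.eqvGen_sound ‹_›)).symm
    | trans _ _ _ _ _ ih₁ ih₂ =>
      exact (ih₁ (Quot.eqvGen_sound ‹_›)).trans (ih₂ (Quot.eqvGen_sound ‹_›))
  exact (hinit b).1 ((hcomp _ _ hab).1 ((hinit a).2 ha))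

end FinGraph

namespace TwoComplex

variable {Y : TwoComplex}

theorem orientedBdry_not (f : Y.F) (b : Bool) :
    Y.orientedBdry (f, !b) = FreeGroup.invRev (Y.orientedBdry (f, b)) := by
  cases b <;> simp [orientedBdry, FreeGroup.invRev_invRev]

theorem length_orientedBdry (p : Y.F × Bool) :
    (Y.orientedBdry p).length = (Y.bdry p.1).length := by
  unfold orientedBdry
  split_ifs
  · rfl
  · exact FreeGroup.invRev_length

theorem cycleChain_orientedBdry {r : Y.Dart → Y.Dart → Prop}
    (hr : ∀ a b, r a b → r (Y.flip b) (Y.flip a)) {f : Y.F} {b : Bool}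
    (h : Cycle.Chain r (Y.orientedBdry (f, b) : Cycle Y.Dart)) (c : Bool) :
    Cycle.Chain r (Y.orientedBdry (f, c) : Cycle Y.Dart) := by
  rcases eq_or_ne c b with rfl | hcb
  · exact h
  · rw [Bool.eq_not_of_ne hcb, orientedBdry_not]
    exact cycleChain_invRev hr h

theorem orientedBdry_ne_nil (p : Y.F × Bool) : Y.orientedBdry p ≠ [] := by
  rw [← List.length_pos_iff, length_orientedBdry, List.length_pos_iff]
  exact (Y.isReducedLoop_bdry p.1).1

/-- A colouring of the oriented edges such that, whenever `b` follows `a` on the boundary of a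
face, the colours of `a⁻¹` and `b` differ. When oriented edges are labelled by words beginning with
their colours, nothing cancels at the corners of the faces. -/
def IsCornerColoring (Y : TwoComplex) {κ : Type*} (col : Y.Dart → κ) : Prop :=
  ∀ p, Cycle.Chain (fun a b => col (Y.flip a) ≠ col b) (Y.orientedBdry p : Cycle Y.Dart)

theorem IsPlanar.exists_isCornerColoring (hY : Y.IsPlanar) {κ : Type*} [Finite κ]
    (hκ : 3 ≤ Nat.card κ) : ∃ col : Y.Dart → κ, Y.IsCornerColoring col := by
  obtain ⟨σ, -, -, o, ho, -⟩ := hY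
  obtain ⟨col, hcol⟩ := exists_coloring_perm hκ σ
  refine ⟨col, fun ⟨f, b⟩ => ?_⟩
  have hturn (b : Bool) :
      Cycle.Chain (fun x y => y ≠ Y.flip x) (Y.orientedBdry (f, b) : Cycle Y.Dart) := by
    refine cycleChain_orientedBdry (b := true) (fun x y hxy h => hxy ?_)
      ((Y.isReducedLoop_bdry f).2.imp fun _ _ => FinGraph.Follows.ne_flip) b
    rw [← Y.flip_flip y, ← h]
  refine cycleChain_orientedBdry (b := o f) (fun x y hxy => ?_)
    ((cycleChain_and (ho f).2 (hturn (o f))).imp fun x y hxy => ?_) b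
  · rw [Y.flip_flip]
    exact hxy.symm
  · obtain ⟨rfl, hne⟩ := hxy
    exact hcol _ hne

/-- If two regions had mutually inverse boundaries, their oriented edges would be closed under
inversion and face tracing and hence exhaust a component, which also has an outer region. -/
theorem IsPlanar.orientedBdry_injective (hY : Y.IsPlanar) :
    Function.Injective Y.orientedBdry := by
  obtain ⟨σ, hσ, -, o, ho, hdisj, houter⟩ := hY
  have hnext (f : Y.F) : ∀ a ∈ Y.orientedBdry (f, o f), Y.trace σ a ∈ Y.orientedBdry (f, o f) := by
    intro a ha
    obtain ⟨_, hb, rfl⟩ := cycleChain_exists_next (ho f).2 ha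
    exact hb
  have hinverse (f g : Y.F) : Y.orientedBdry (f, o f) ≠ Y.orientedBdry (g, !(o g)) := by
    intro h
    have hmem (a : Y.Dart) :
        a ∈ Y.orientedBdry (f, o f) ↔ Y.flip a ∈ Y.orientedBdry (g, o g) := by
      rw [h, orientedBdry_not, mem_invRev]
      rfl
    obtain ⟨a, ha⟩ := List.exists_mem_of_ne_nil _ (orientedBdry_ne_nil (f, o f))
    obtain ⟨b, hb, hb'⟩ := houter a
    have : b ∈ {x | x ∈ Y.orientedBdry (f, o f) ∨ x ∈ Y.orientedBdry (g, o g)} := by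
      refine hσ.mem_of_component_eq ?_ ?_ (Or.inl ha) hb.symm
      · exact fun x hx => hx.symm.imp (fun hx => (hmem _).2 (by rwa [Y.flip_flip])) (hmem x).1
      · exact fun x hx => hx.imp (hnext f x) (hnext g x)
    exact this.elim (hb' f) (hb' g)
  have hregion (f g : Y.F) (c : Bool) (h : Y.orientedBdry (f, o f) = Y.orientedBdry (g, c)) :
      (f, o f) = (g, c) := by
    have hc : c = o g := by
      by_contra hc
      exact hinverse f g (by rwa [← Bool.eq_not_of_ne hc])
    subst hc
    obtain ⟨a, ha⟩ := List.exists_mem_of_ne_nil _ (orientedBdry_ne_nil (f, o f))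
    have hfg : f = g := by
      by_contra hfg
      exact hdisj f g hfg ha (h ▸ ha)
    rw [hfg]
  rintro ⟨f, b⟩ ⟨g, c⟩ h
  rcases eq_or_ne b (o f) with rfl | hb
  · exact hregion f g c h
  · obtain rfl := Bool.eq_not_of_ne hb
    have hinv : Y.orientedBdry (f, o f) = Y.orientedBdry (g, !c) := by
      rw [orientedBdry_not, ← h, orientedBdry_not, FreeGroup.invRev_invRev]
    simpa [Prod.ext_iff, Bool.eq_not] using hregion f g (!c) hinv

end TwoComplex
end Planar

section BoundaryLength

theorem ncard_getElem?_eq_some {α : Type*} [DecidableEq α] (l : List α) (a : α) :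
    {i : ℕ | l[i]? = some a}.ncard = l.count a := by
  let v : List.Vector α l.length := ⟨l, rfl⟩
  have himage : {i : ℕ | l[i]? = some a} = Fin.val '' {i | v.get i = a} := by
    ext i
    simp [v, List.Vector.get, List.getElem?_eq_some_iff, Fin.exists_iff, and_comm]
  rw [himage, Set.ncard_image_of_injective _ Fin.val_injective, Set.ncard_eq_toFinset_card',
    Set.toFinset_ofPred]
  exact Fin.card_filter_univ_eq_vector_get_eq_count a v

theorem count_map_fst {α : Type*} [DecidableEq α] (l : List (α × Bool)) (a : α) :
    (l.map Prod.fst).count a = l.count (a, true) + l.count (a, false) := by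
  induction l with
  | nil => rfl
  | cons x l ih => obtain ⟨c, _ | _⟩ := x <;> grind

theorem sum_count_le_one {ι α : Type*} [BEq α] [LawfulBEq α] {l : ι → List α}
    (hnodup : ∀ i, (l i).Nodup) (hdisj : ∀ i j, i ≠ j → (l i).Disjoint (l j)) (A : Finset ι)
    (a : α) : ∑ i ∈ A, (l i).count a ≤ 1 := by
  by_cases h : ∃ i ∈ A, a ∈ l i
  · obtain ⟨i, hi, ha⟩ := h
    rw [Finset.sum_eq_single_of_mem i hi fun j _ hji =>
      List.count_eq_zero.2 fun haj => hdisj j i hji haj ha]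
    exact List.nodup_iff_count_le_one.1 (hnodup i) a
  · push Not at h
    rw [Finset.sum_eq_zero fun i hi => List.count_eq_zero.2 (h i hi)]
    exact zero_le_one

namespace TwoComplex

variable {Y : TwoComplex}

theorem map_fst_orientedBdry_perm (p : Y.F × Bool) :
    ((Y.orientedBdry p).map Prod.fst).Perm ((Y.bdry p.1).map Prod.fst) := by
  obtain ⟨f, _ | _⟩ := p
  · simp [orientedBdry, FreeGroup.invRev, Function.comp_def, List.reverse_perm]
  · rfl

theorem Sub.adjacency_eq_sum_count [DecidableEq Y.E] (Z : Y.Sub) {A : Finset Y.F}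
    (hA : Z.faces = A) (e : Y.E) :
    Z.adjacency e = ∑ f ∈ A, ((Y.bdry f).map Prod.fst).count e := by
  have hpassage : {p : Y.F × ℕ | p.1 ∈ Z.faces ∧ ∃ b : Bool, (Y.bdry p.1)[p.2]? = some (e, b)} =
      ⋃ f ∈ (A : Set Y.F), Prod.mk f '' {i : ℕ | ((Y.bdry f).map Prod.fst)[i]? = some e} := by
    ext ⟨f, i⟩
    simp [hA, and_comm]
  have hfinite (f : Y.F) : {i : ℕ | ((Y.bdry f).map Prod.fst)[i]? = some e}.Finite :=
    (Set.finite_lt_nat _).subset fun i hi => (List.getElem?_eq_some_iff.1 hi).1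
  have hdisj : (A : Set Y.F).PairwiseDisjoint
      fun f => Prod.mk f '' {i : ℕ | ((Y.bdry f).map Prod.fst)[i]? = some e} := by
    intro f _ g _ hfg
    refine Set.disjoint_left.2 ?_
    rintro _ ⟨i, -, rfl⟩ ⟨j, -, h⟩
    exact hfg (congrArg Prod.fst h).symm
  rw [adjacency, hpassage, A.finite_toSet.ncard_biUnion (fun f _ => (hfinite f).image _) hdisj,
    finsum_mem_coe_finset]
  refine Finset.sum_congr rfl fun f _ => ?_
  rw [Set.ncard_image_of_injective _ (Prod.mk_right_injective f), ncard_getElem?_eq_some]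

theorem IsPlanar.adjacency_le_two (hY : Y.IsPlanar) (Z : Y.Sub) (e : Y.E) :
    Z.adjacency e ≤ 2 := by
  classical
  obtain ⟨σ, -, -, o, ho, hdisj, -⟩ := hY
  have hside := sum_count_le_one (α := Y.E × Bool) (fun f => (ho f).1) hdisj
  calc Z.adjacency e
      = ∑ f ∈ Z.faces.toFinite.toFinset, ((Y.bdry f).map Prod.fst).count e :=
        Z.adjacency_eq_sum_count (by simp) e
    _ = ∑ f ∈ Z.faces.toFinite.toFinset, ((Y.orientedBdry (f, o f)).count (e, true) +
          (Y.orientedBdry (f, o f)).count (e, false)) :=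
        Finset.sum_congr rfl fun f _ => by
          rw [← count_map_fst, (map_fst_orientedBdry_perm (f, o f)).count_eq]
    _ ≤ 1 + 1 := by
        rw [Finset.sum_add_distrib]
        exact add_le_add (hside _ _) (hside _ _)

theorem Sub.sum_adjacency (Z : Y.Sub) {A : Finset Y.F} (hA : Z.faces = A) {T : Finset Y.E}
    (hT : Z.edges = T) : ∑ e ∈ T, Z.adjacency e = ∑ f ∈ A, (Y.bdry f).length := by
  classical
  simp_rw [Z.adjacency_eq_sum_count hA]
  rw [Finset.sum_comm]
  refine Finset.sum_congr rfl fun f hf => ?_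
  have hmem : ∀ e ∈ (((Y.bdry f).map Prod.fst : List Y.E) : Multiset Y.E), e ∈ T := by
    intro e he
    obtain ⟨a, ha, rfl⟩ := List.mem_map.1 (Multiset.mem_coe.1 he)
    have : a.1 ∈ Z.edges := Z.bdry_mem f (hA ▸ hf) a ha
    rwa [hT] at this
  simpa using Multiset.sum_count_eq_card hmem

theorem Sub.two_mul_ncard_edges (Z : Y.Sub) (hZ : ∀ e, Z.adjacency e ≤ 2) {A : Finset Y.F}
    (hA : Z.faces = A) :
    2 * Z.edges.ncard = ∑ f ∈ A, (Y.bdry f).length + Z.bdryLength := by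
  classical
  let T := Z.edges.toFinite.toFinset
  have hT : Z.edges = T := by simp [T]
  have hsum (k : ℕ) : {e ∈ Z.edges | Z.adjacency e = k}.ncard =
      ∑ e ∈ T, if Z.adjacency e = k then 1 else 0 := by
    rw [Finset.sum_boole, Nat.cast_id, ← Set.ncard_coe_finset]
    congr 1
    ext e
    simp [T]
  rw [← Z.sum_adjacency hA hT, bdryLength, hsum, hsum, hT, Set.ncard_coe_finset,
    Finset.card_eq_sum_ones, Finset.mul_sum, Finset.mul_sum, ← Finset.sum_add_distrib,
    ← Finset.sum_add_distrib]
  refine Finset.sum_congr rfl fun e _ => ?_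
  have := hZ e
  split_ifs <;> lia

/-- The edges on the boundaries of the faces in `A`. -/
noncomputable def bdryEdges (A : Finset Y.F) : Finset Y.E :=
  open Classical in A.biUnion fun f => ((Y.bdry f).map Prod.fst).toFinset

theorem mem_bdryEdges {A : Finset Y.F} {e : Y.E} :
    e ∈ bdryEdges A ↔ ∃ f ∈ A, ∃ a ∈ Y.bdry f, a.1 = e := by
  simp only [bdryEdges, Finset.mem_biUnion, List.mem_toFinset, List.mem_map]

theorem card_bdryEdges_singleton_le (f : Y.F) :
    (bdryEdges {f}).card ≤ (Y.bdry f).length := by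
  classical
  rw [bdryEdges, Finset.singleton_biUnion, ← (Y.bdry f).length_map (f := Prod.fst)]
  exact List.toFinset_card_le _

/-- The sub-2-complex with the faces in `A`, the edges on their boundaries, and all vertices. -/
def closure (A : Finset Y.F) : Y.Sub where
  verts := Set.univ
  edges := bdryEdges A
  faces := A
  src_mem _ _ := Set.mem_univ _
  tgt_mem _ _ := Set.mem_univ _
  bdry_mem f hf a ha := mem_bdryEdges.2 ⟨f, hf, a, ha, rfl⟩

theorem IsPlanar.two_mul_card_bdryEdges (hY : Y.IsPlanar) (A : Finset Y.F) :
    2 * (bdryEdges A).card = ∑ f ∈ A, (Y.bdry f).length + (closure A).bdryLength := by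
  rw [← (closure A).two_mul_ncard_edges (hY.adjacency_le_two _) rfl]
  simp [closure]

theorem IsPlanar.le_card_bdryEdges (hY : Y.IsPlanar) {ℓ : ℕ}
    (hlength : ∀ f, (Y.bdry f).length = ℓ) {c : ℝ} {A : Finset Y.F}
    (hiso : c * A.card * ℓ ≤ (closure A).bdryLength) :
    (1 + c) / 2 * A.card * ℓ ≤ (bdryEdges A).card := by
  have hcount : 2 * ((bdryEdges A).card : ℝ) = A.card * ℓ + (closure A).bdryLength := by
    have := hY.two_mul_card_bdryEdges A
    rw [Finset.sum_congr rfl fun f _ => hlength f, Finset.sum_const, smul_eq_mul] at this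
    exact_mod_cast this
  linarith

end TwoComplex
end BoundaryLength

section Concatenation

theorem cycleChain_flatMap {α β : Type*} {r : β → β → Prop} {W : α → List β}
    (hW : ∀ a, W a ≠ []) (l : List α) :
    Cycle.Chain r (l.flatMap W : Cycle β) ↔ (∀ a ∈ l, (W a).IsChain r) ∧
      Cycle.Chain (fun a b => ∀ x ∈ (W a).getLast?, ∀ y ∈ (W b).head?, r x y) (l : Cycle α) := by
  obtain _ | ⟨a, t⟩ := l
  · simp
  have hclosed : ((a :: (t ++ [a])).flatMap W).IsChain r ↔ (∀ c ∈ a :: t, (W c).IsChain r) ∧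
      Cycle.Chain (fun a b => ∀ x ∈ (W a).getLast?, ∀ y ∈ (W b).head?, r x y)
        ((a :: t : List α) : Cycle α) := by
    rw [List.flatMap_def, List.isChain_flatten (by simp [hW]),
      List.isChain_map, Cycle.chain_coe_cons]
    simp only [List.forall_mem_map, List.forall_mem_cons, List.forall_mem_append]
    tauto
  obtain ⟨x, p, hp⟩ := List.exists_cons_of_ne_nil (hW a)
  have hopen : (a :: t).flatMap W = x :: (p ++ t.flatMap W) := by
    rw [List.flatMap_cons, hp, List.cons_append]
  have hsplit : (a :: (t ++ [a])).flatMap W = x :: (p ++ t.flatMap W) ++ [x] ++ p := by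
    simp [hp]
  rw [← hclosed, hopen, hsplit, Cycle.chain_coe_cons]
  refine ⟨fun h => List.IsChain.append_overlap h ?_ (List.cons_ne_nil _ _),
    fun h => h.left_of_append⟩
  exact h.infix ⟨[], t.flatMap W ++ [x], by simp⟩

theorem invRev_map {α β : Type*} {φ : α × Bool → β × Bool}
    (hφ : ∀ a, φ (a.1, !a.2) = ((φ a).1, !(φ a).2)) (l : List (α × Bool)) :
    FreeGroup.invRev (l.map φ) = (FreeGroup.invRev l).map φ := by
  simp [FreeGroup.invRev, Function.comp_def, hφ]

theorem invRev_flatMap {α β : Type*} {W : α × Bool → List (β × Bool)}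
    (hW : ∀ a, W (a.1, !a.2) = FreeGroup.invRev (W a)) (l : List (α × Bool)) :
    FreeGroup.invRev (l.flatMap W) = (FreeGroup.invRev l).flatMap W := by
  induction l with
  | nil => rfl
  | cons a t ih =>
    rw [FreeGroup.invRev_cons, List.flatMap_append, ← ih, List.flatMap_cons,
      FreeGroup.invRev_append, ← hW]
    simp [FreeGroup.invRev]

theorem head?_invRev {α : Type*} (l : List (α × Bool)) :
    (FreeGroup.invRev l).head? = l.getLast?.map fun x => (x.1, !x.2) := by
  simp [FreeGroup.invRev, List.head?_reverse, List.getLast?_map]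

theorem isCyclicallyReduced_of_cycleChain {α : Type*} {w : List (α × Bool)}
    (h : Cycle.Chain (fun a b : α × Bool => a.1 = b.1 → a.2 = b.2) (w : Cycle (α × Bool))) :
    FreeGroup.IsCyclicallyReduced w := by
  obtain _ | ⟨a, t⟩ := w
  · exact FreeGroup.IsCyclicallyReduced.nil
  rw [Cycle.chain_coe_cons, ← List.cons_append, List.isChain_append] at h
  exact ⟨h.1, fun x hx y hy => h.2.2 x hx y (by simpa using hy)⟩

theorem eq_of_flatMap_eq_flatMap {α β : Type*} {W W' : α → List β}
    (hlen : ∀ a, (W a).length = (W' a).length) {l : List α} (h : l.flatMap W = l.flatMap W') :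
    ∀ a ∈ l, W a = W' a := by
  induction l with
  | nil => simp
  | cons b t ih =>
    obtain ⟨hb, ht⟩ := List.append_inj h (hlen b)
    exact List.forall_mem_cons.2 ⟨hb, ih ht⟩

theorem flatMap_injective_of_prefix {α β : Type*} {W c : α → List β} {q : ℕ} (hq : 0 < q)
    (hc : Function.Injective c) (hlen : ∀ a, (c a).length = q) (hpre : ∀ a, c a <+: W a) :
    Function.Injective fun l : List α => l.flatMap W := by
  have hW (a : α) : W a ≠ [] := List.ne_nil_of_length_pos <|
    hq.trans_le (hlen a ▸ (hpre a).length_le)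
  intro l
  induction l with
  | nil =>
    rintro (_ | ⟨b, t⟩) h
    · rfl
    · exact absurd (List.append_eq_nil_iff.1 h.symm).1 (hW b)
  | cons a s ih =>
    rintro (_ | ⟨b, t⟩) h
    · exact absurd (List.append_eq_nil_iff.1 h).1 (hW a)
    simp only [List.flatMap_cons] at h
    have ha : c a <+: W a ++ s.flatMap W := (hpre a).trans (List.prefix_append _ _)
    have hb : c b <+: W a ++ s.flatMap W := h ▸ (hpre b).trans (List.prefix_append _ _)
    obtain rfl : a = b := hc <| (List.prefix_of_prefix_length_le ha hb
      (by rw [hlen, hlen])).eq_of_length (by rw [hlen, hlen])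
    rw [ih (List.append_cancel_left h)]

theorem ncard_mul_prod_card_le {ι : Type*} [Finite ι] {W : ι → Type*} [∀ i, Finite (W i)]
    (T : Finset ι) (S : Set (∀ i, W i)) (hS : ∀ y ∈ S, ∀ z ∈ S, ∀ i ∈ T, y i = z i) :
    S.ncard * ∏ i ∈ T, Nat.card (W i) ≤ Nat.card (∀ i, W i) := by
  classical
  have := Fintype.ofFinite ι
  have hcompl : S.ncard ≤ ∏ i ∈ Tᶜ, Nat.card (W i) := by
    rw [← Finset.prod_coe_sort, ← Nat.card_pi, ← Nat.card_coe_set_eq]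
    refine Nat.card_le_card_of_injective (fun (y : S) (i : (Tᶜ : Finset ι)) => y.1 i.1) ?_
    refine fun y z h => Subtype.ext (funext fun i => ?_)
    by_cases hi : i ∈ T
    · exact hS y y.2 z z.2 i hi
    · exact congrFun h ⟨i, Finset.mem_compl.2 hi⟩
  rw [Nat.card_pi, ← Finset.prod_compl_mul_prod T]
  exact Nat.mul_le_mul_right _ hcompl

end Concatenation

section Subdivision
namespace TwoComplex

variable {Y : TwoComplex} {n : Y.E → ℕ+}

theorem divPath_flip (a : Y.Dart) :
    Y.divPath n (a.1, !a.2) = FreeGroup.invRev (Y.divPath n a) := by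
  obtain ⟨e, _ | _⟩ := a <;> simp [divPath, FreeGroup.invRev_invRev]

theorem length_divPath (a : Y.Dart) : (Y.divPath n a).length = n a.1 := by
  rw [divPath_eq]
  split_ifs <;> simp

theorem mem_divPath {a : Y.Dart} {x : (Y.divGraph n).Dart} :
    x ∈ Y.divPath n a ↔ x.1.1 = a.1 ∧ x.2 = a.2 := by
  rw [divPath_eq]
  constructor
  · split_ifs with ha <;> simp only [List.mem_reverse, List.mem_ofFn] <;> rintro ⟨i, rfl⟩ <;>
      simp [ha]
  · obtain ⟨⟨e, i⟩, b⟩ := x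
    obtain ⟨e', b'⟩ := a
    rintro ⟨rfl, rfl⟩
    cases b <;> simp

theorem orientedBdry_subdivide (p : Y.F × Bool) :
    (Y.subdivide n).orientedBdry p = (Y.orientedBdry p).flatMap (Y.divPath n) := by
  obtain ⟨f, _ | _⟩ := p
  · exact invRev_flatMap divPath_flip _
  · rfl

theorem orientedBdry_injective_of_subdivide
    (h : Function.Injective (Y.subdivide n).orientedBdry) : Function.Injective Y.orientedBdry :=
  fun p q hpq => h <| (orientedBdry_subdivide p).trans <|
    (congrArg (List.flatMap (Y.divPath n)) hpq).trans (orientedBdry_subdivide q).symm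

theorem IsCornerColoring.of_subdivide {κ : Type*} {col : (Y.subdivide n).Dart → κ}
    (h : (Y.subdivide n).IsCornerColoring col) :
    Y.IsCornerColoring fun a => col ((Y.divPath n a).head (Y.divPath_ne_nil n a)) := by
  intro p
  have hp : Cycle.Chain (fun x y => col ((Y.divGraph n).flip x) ≠ col y)
      ((Y.orientedBdry p).flatMap (Y.divPath n) : Cycle (Y.divGraph n).Dart) :=
    orientedBdry_subdivide (n := n) p ▸ h p
  refine ((cycleChain_flatMap (Y.divPath_ne_nil n) _).1 hp).2.imp fun a b hab => ?_
  have hflip := head?_invRev (Y.divPath n a)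
  rw [← divPath_flip, List.head?_eq_some_head (Y.divPath_ne_nil n _),
    List.getLast?_eq_some_getLast (Y.divPath_ne_nil n a), Option.map_some,
    Option.some.injEq] at hflip
  convert hab _ (List.getLast?_eq_some_getLast (Y.divPath_ne_nil n a)) _
    (List.head?_eq_some_head (Y.divPath_ne_nil n b)) using 2
  exact congrArg col hflip

theorem card_bdryEdges_subdivide (A : Finset Y.F) :
    (bdryEdges (Y := Y.subdivide n) A).card = ∑ e ∈ bdryEdges A, (n e : ℕ) := by
  have hsigma : bdryEdges (Y := Y.subdivide n) A =
      (bdryEdges A).sigma fun e => (Finset.univ : Finset (Fin (n e : ℕ))) := by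
    ext ⟨e, i⟩
    refine mem_bdryEdges.trans (Iff.trans ?_ Finset.mem_sigma.symm)
    rw [mem_bdryEdges, and_iff_left (Finset.mem_univ _)]
    refine exists_congr fun f => and_congr_right fun _ => ⟨?_, ?_⟩
    · rintro ⟨x, hx, hxe⟩
      obtain ⟨a, ha, hxa⟩ := List.mem_flatMap.1 hx
      exact ⟨a, ha, (mem_divPath.1 hxa).1.symm.trans (congrArg Sigma.fst hxe)⟩
    · rintro ⟨a, ha, rfl⟩
      exact ⟨(⟨a.1, i⟩, a.2), List.mem_flatMap.2 ⟨a, ha, mem_divPath.2 ⟨rfl, rfl⟩⟩, rfl⟩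
  rw [hsigma]
  exact (Finset.card_sigma _ _).trans (by simp)

end TwoComplex
end Subdivision

section Labelings

/-- Distinct code words of one length for the oriented edges, whose first letters form a corner
colouring. Words that begin with the code words of the oriented edges are concatenated along the
faces without cancellation, and the concatenation determines the path. -/
structure CornerCode (m : ℕ) (Y : TwoComplex) where
  q : ℕ
  q_pos : 0 < q
  word : Y.Dart → Word m
  injective_word : Function.Injective word
  length_word : ∀ a, (word a).length = q
  isReduced_word : ∀ a, FreeGroup.IsReduced (word a)
  firstLetter : Y.Dart → Fin m × Bool
  head?_word : ∀ a, (word a).head? = some (firstLetter a)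
  isCornerColoring : Y.IsCornerColoring firstLetter

variable {m : ℕ} {Y : TwoComplex}

theorem TwoComplex.IsCornerColoring.nonempty_cornerCode (hm : 2 ≤ m) {col : Y.Dart → Fin m × Bool}
    (hcol : Y.IsCornerColoring col) : Nonempty (CornerCode m Y) := by
  obtain ⟨q, hq, c, hc, h⟩ := exists_injective_isReduced_head hm col
  exact ⟨⟨q, hq, c, hc, fun a => (h a).1, fun a => (h a).2.1, col, fun a => (h a).2.2, hcol⟩⟩

namespace CornerCode

variable {C : CornerCode m Y} {n : Y.E → ℕ+}

/-- Reduced words of lengths `n` along the edges, such that the word along every oriented edge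
begins with its code word. -/
abbrev Labeling (C : CornerCode m Y) (n : Y.E → ℕ+) : Type :=
  (e : Y.E) → edgeWords m (n e) (C.word (e, true)) (C.word (e, false))

theorem pow_le_card_edgeWords (C : CornerCode m Y) (hm : 2 ≤ m) {e : Y.E}
    (hn : 2 * C.q + 1 ≤ (n e : ℕ)) :
    (2 * m - 1) ^ (n e : ℕ) ≤ (2 * m - 1) ^ (2 * C.q + 1) *
      Nat.card (edgeWords m (n e) (C.word (e, true)) (C.word (e, false))) := by
  rw [← Nat.add_sub_cancel' hn, pow_add, Nat.add_sub_cancel' hn]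
  exact Nat.mul_le_mul_left _ <| le_card_edgeWords hm (C.isReduced_word _) (C.isReduced_word _)
    (C.length_word _) (C.length_word _) C.q_pos hn

theorem nonempty_labeling (C : CornerCode m Y) (hm : 2 ≤ m)
    (hn : ∀ e, 2 * C.q + 1 ≤ (n e : ℕ)) : Nonempty (C.Labeling n) :=
  Classical.nonempty_pi.2 fun e => (Nat.card_pos_iff.1 <| Nat.pos_of_mul_pos_left <|
    (Nat.pow_pos (by lia)).trans_le (C.pow_le_card_edgeWords hm (hn e))).1

/-- The word along an oriented edge. -/
def dartWord (x : C.Labeling n) (a : Y.Dart) : Word m :=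
  if a.2 then (x a.1).1 else FreeGroup.invRev (x a.1).1

/-- The word along the boundary of an oriented face. -/
def faceWord (x : C.Labeling n) (p : Y.F × Bool) : Word m := (Y.orientedBdry p).flatMap (dartWord x)

/-- The letter on an oriented edge of the subdivision. -/
def edgeLetter (x : C.Labeling n) (a : (Y.divGraph n).Dart) : Fin m × Bool :=
  let y := (x a.1.1).1[(a.1.2 : ℕ)]'(by rw [(x a.1.1).2.1]; exact a.1.2.2)
  if a.2 then y else (y.1, !y.2)

theorem dartWord_flip (x : C.Labeling n) (a : Y.Dart) :
    dartWord x (a.1, !a.2) = FreeGroup.invRev (dartWord x a) := by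
  obtain ⟨e, _ | _⟩ := a <;> simp [dartWord, FreeGroup.invRev_invRev]

theorem length_dartWord (x : C.Labeling n) (a : Y.Dart) : (dartWord x a).length = n a.1 := by
  unfold dartWord
  split_ifs
  · exact (x a.1).2.1
  · exact FreeGroup.invRev_length.trans (x a.1).2.1

theorem dartWord_ne_nil (x : C.Labeling n) (a : Y.Dart) : dartWord x a ≠ [] :=
  List.ne_nil_of_length_pos (length_dartWord x a ▸ (n a.1).pos)

theorem isReduced_dartWord (x : C.Labeling n) (a : Y.Dart) :
    FreeGroup.IsReduced (dartWord x a) := by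
  unfold dartWord
  split_ifs
  · exact (x a.1).2.2.1
  · exact isReduced_invRev (x a.1).2.2.1

theorem prefix_dartWord (x : C.Labeling n) (a : Y.Dart) : C.word a <+: dartWord x a := by
  obtain ⟨e, _ | _⟩ := a
  · exact (x e).2.2.2.2
  · exact (x e).2.2.2.1

theorem head?_dartWord (x : C.Labeling n) (a : Y.Dart) :
    (dartWord x a).head? = some (C.firstLetter a) := by
  obtain ⟨t, ht⟩ := prefix_dartWord x a
  rw [← ht, List.head?_append, C.head?_word, Option.some_or]

theorem dartWord_injective (a : Y.Dart) {x y : C.Labeling n} (h : dartWord x a = dartWord y a) :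
    x a.1 = y a.1 := by
  unfold dartWord at h
  split_ifs at h
  · exact Subtype.ext h
  · exact Subtype.ext (FreeGroup.invRev_injective h)

theorem faceWord_not (x : C.Labeling n) (f : Y.F) (b : Bool) :
    faceWord x (f, !b) = FreeGroup.invRev (faceWord x (f, b)) := by
  rw [faceWord, TwoComplex.orientedBdry_not, ← invRev_flatMap (dartWord_flip x), faceWord]

theorem faceWord_injective (hbdry : Function.Injective Y.orientedBdry) (x : C.Labeling n) :
    Function.Injective (faceWord x) :=
  (flatMap_injective_of_prefix C.q_pos C.injective_word C.length_word (prefix_dartWord x)).comp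
    hbdry

theorem isCyclicallyReduced_faceWord (x : C.Labeling n) (p : Y.F × Bool) :
    FreeGroup.IsCyclicallyReduced (faceWord x p) := by
  refine isCyclicallyReduced_of_cycleChain <| (cycleChain_flatMap (dartWord_ne_nil x) _).2
    ⟨fun a _ => isReduced_dartWord x a, (C.isCornerColoring p).imp ?_⟩
  intro a b hab y hy z hz hyz
  have hflip := head?_dartWord x (Y.flip a)
  rw [show dartWord x (Y.flip a) = _ from dartWord_flip x a, head?_invRev, Option.mem_def.1 hy,
    Option.map_some, Option.some.injEq] at hflip
  rw [← hflip, ← Option.some.inj ((Option.mem_def.1 hz).symm.trans (head?_dartWord x b))] at hab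
  by_contra hne
  exact hab (Prod.ext hyz (Bool.not_eq.2 hne))

theorem edgeLetter_flip (x : C.Labeling n) (a : (Y.divGraph n).Dart) :
    edgeLetter x (a.1, !a.2) = ((edgeLetter x a).1, !(edgeLetter x a).2) := by
  obtain ⟨e, _ | _⟩ := a <;> simp [edgeLetter]

theorem map_edgeLetter_divPath (x : C.Labeling n) (a : Y.Dart) :
    (Y.divPath n a).map (edgeLetter x) = dartWord x a := by
  have htrue (e : Y.E) : (Y.divPath n (e, true)).map (edgeLetter x) = dartWord x (e, true) := by
    refine List.ext_getElem ?_ fun i _ _ => ?_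
    · rw [List.length_map, TwoComplex.length_divPath, length_dartWord]
    · simp [TwoComplex.divPath, dartWord, edgeLetter]
  obtain ⟨e, _ | _⟩ := a
  · calc (Y.divPath n (e, false)).map (edgeLetter x)
        = FreeGroup.invRev ((Y.divPath n (e, true)).map (edgeLetter x)) := by
          rw [invRev_map (edgeLetter_flip x), ← TwoComplex.divPath_flip, Bool.not_true]
      _ = dartWord x (e, false) := by rw [htrue, ← dartWord_flip, Bool.not_true]
  · exact htrue e

theorem map_edgeLetter_orientedBdry (x : C.Labeling n) (p : Y.F × Bool) :
    ((Y.subdivide n).orientedBdry p).map (edgeLetter x) = faceWord x p := by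
  refine (congrArg (List.map (edgeLetter x)) (TwoComplex.orientedBdry_subdivide p)).trans ?_
  rw [List.map_flatMap, faceWord]
  simp only [map_edgeLetter_divPath]

theorem length_faceWord (x : C.Labeling n) (f : Y.F) :
    (faceWord x (f, true)).length = ((Y.subdivide n).bdry f).length :=
  (congrArg List.length (map_edgeLetter_orientedBdry x (f, true))).symm.trans (List.length_map _)

theorem fillable_of_faceWord_mem (hbdry : Function.Injective Y.orientedBdry) {R : Set (Word m)}
    (x : C.Labeling n) (hx : ∀ f, faceWord x (f, true) ∈ R) : (Y.subdivide n).Fillable m R := by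
  have hmem : ∀ p, faceWord x p ∈ R ∨ FreeGroup.invRev (faceWord x p) ∈ R
    | (f, true) => Or.inl (hx f)
    | (f, false) => Or.inr (faceWord_not x f false ▸ hx f)
  let diagram : VanKampen m R (Y.subdivide n) :=
    { edgeLabel := edgeLetter x
      edgeLabel_inv := fun e b => edgeLetter_flip x (e, b)
      faceLabel := fun p => faceWord x p
      faceLabel_mem := hmem
      faceLabel_inv := faceWord_not x
      compatible := map_edgeLetter_orientedBdry x }
  exact ⟨diagram, fun f g hfg h => absurd (faceWord_injective hbdry x h) hfg⟩

theorem ncard_faceWord_eq_mul_le (hm : 2 ≤ m) (hn : ∀ e, 2 * C.q + 1 ≤ (n e : ℕ))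
    (A : Finset Y.F) (v : Y.F → Word m) :
    {y : C.Labeling n | ∀ f ∈ A, faceWord y (f, true) = v f}.ncard *
        (2 * m - 1) ^ (∑ e ∈ TwoComplex.bdryEdges A, (n e : ℕ)) ≤
      ((2 * m - 1) ^ (2 * C.q + 1)) ^ Nat.card Y.E * Nat.card (C.Labeling n) := by
  have := Fintype.ofFinite Y.E
  set T := TwoComplex.bdryEdges A
  let W (e : Y.E) := edgeWords m (n e) (C.word (e, true)) (C.word (e, false))
  have hpow : (2 * m - 1) ^ (∑ e ∈ T, (n e : ℕ)) ≤
      ((2 * m - 1) ^ (2 * C.q + 1)) ^ Nat.card Y.E * ∏ e ∈ T, Nat.card (W e) :=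
    calc (2 * m - 1) ^ (∑ e ∈ T, (n e : ℕ))
        ≤ ∏ e ∈ T, (2 * m - 1) ^ (2 * C.q + 1) * Nat.card (W e) := by
          rw [← Finset.prod_pow_eq_pow_sum]
          exact Finset.prod_le_prod' fun e _ => C.pow_le_card_edgeWords hm (hn e)
      _ ≤ _ := by
          rw [Finset.prod_mul_distrib, Finset.prod_const, Nat.card_eq_fintype_card]
          gcongr
          · exact Nat.one_le_pow _ _ (by lia)
          · exact T.card_le_univ
  have hdetermined := ncard_mul_prod_card_le (W := fun e => W e) T
    {y : C.Labeling n | ∀ f ∈ A, faceWord y (f, true) = v f} fun y hy z hz e he => by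
      obtain ⟨f, hf, a, ha, rfl⟩ := TwoComplex.mem_bdryEdges.1 he
      exact dartWord_injective a <| eq_of_flatMap_eq_flatMap
        (fun a => (length_dartWord y a).trans (length_dartWord z a).symm)
        ((hy f hf).trans (hz f hf).symm) a ha
  calc _ ≤ _ := Nat.mul_le_mul_left _ hpow
    _ = _ := Nat.mul_left_comm _ _ _
    _ ≤ _ := Nat.mul_le_mul_left _ hdetermined

theorem measureReal_not_fillable_le (C : CornerCode m Y) (hm : 2 ≤ m)
    (hbdry : Function.Injective Y.orientedBdry) (hn : ∀ e, 2 * C.q + 1 ≤ (n e : ℕ)) {ℓ : ℕ}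
    (hlength : ∀ f, ((Y.subdivide n).bdry f).length ≤ ℓ)
    {Ω : Type*} [MeasurableSpace Ω] {P : Measure Ω} [IsProbabilityMeasure P] {R : Ω → Set (B m ℓ)}
    (hmeas : ∀ S, MeasurableSet {ω | R ω = S})
    (hinv : ∀ (π : Equiv.Perm (B m ℓ)) S, P {ω | R ω = π '' S} = P {ω | R ω = S})
    {r₀ τ : ℝ} (hr₀ : 0 < r₀) (hcard : 2 * Nat.card Y.F ≤ r₀) (hτ : 0 ≤ τ)
    (H : ∀ A : Finset Y.F, A.Nonempty → (2 * Nat.card (B m ℓ) / r₀) ^ A.card ≤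
      τ * ((2 * m - 1 : ℕ) : ℝ) ^ (∑ e ∈ TwoComplex.bdryEdges A, (n e : ℕ))) :
    P.real {ω | r₀ ≤ (R ω).ncard ∧ ¬ (Y.subdivide n).Fillable m (Subtype.val '' R ω)} ≤
      2 ^ Nat.card Y.F * (Nat.card Y.F : ℝ) ^ Nat.card Y.F *
        (((2 * m - 1 : ℕ) ^ (2 * C.q + 1)) ^ Nat.card Y.E * τ) := by
  have := Fintype.ofFinite Y.F
  have := Fintype.ofFinite (B m ℓ)
  have := Fintype.ofFinite (C.Labeling n)
  have := C.nonempty_labeling hm hn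
  let w (x : C.Labeling n) (f : Y.F) : B m ℓ := ⟨faceWord x (f, true),
    isCyclicallyReduced_faceWord x _, (length_faceWord x f).trans_le (hlength f)⟩
  have hw (x : C.Labeling n) : Function.Injective (w x) := fun f g h =>
    congrArg Prod.fst (faceWord_injective hbdry x (congrArg Subtype.val h))
  have hsubset : {ω | r₀ ≤ (R ω).ncard ∧ ¬ (Y.subdivide n).Fillable m (Subtype.val '' R ω)} ⊆
      {ω | r₀ ≤ (R ω).ncard ∧ ∀ x, ∃ f, w x f ∉ R ω} := by
    refine fun ω hω => ⟨hω.1, fun x => ?_⟩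
    by_contra! h
    exact hω.2 (fillable_of_faceWord_mem hbdry x fun f => ⟨w x f, h f, rfl⟩)
  refine (measureReal_mono hsubset).trans ?_
  simp only [Nat.card_eq_fintype_card] at hcard H ⊢
  refine measureReal_forall_exists_notMem_le hmeas hinv w hw hr₀ hcard (by positivity)
    fun A hA v => ?_
  have hcount := ncard_faceWord_eq_mul_le (C := C) hm hn A fun f => (v f).1
  simp only [w, Subtype.ext_iff]
  rw [Nat.card_eq_fintype_card (α := C.Labeling n)] at hcount
  rify at hcount
  calc _ ≤ ({y : C.Labeling n | ∀ f ∈ A, faceWord y (f, true) = v f}.ncard : ℝ) *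
          (τ * ((2 * m - 1 : ℕ) : ℝ) ^ (∑ e ∈ TwoComplex.bdryEdges A, (n e : ℕ))) :=
        mul_le_mul_of_nonneg_left (H A hA) (Nat.cast_nonneg _)
    _ ≤ _ := by linarith [mul_le_mul_of_nonneg_left hcount hτ]

end CornerCode
end Labelings

section Limit

theorem tendsto_measureReal_one {ι : Type*} {l : Filter ι} {Ω : ι → Type*}
    [∀ i, MeasurableSpace (Ω i)] {P : ∀ i, Measure (Ω i)} [∀ i, IsProbabilityMeasure (P i)]
    {S T : ∀ i, Set (Ω i)} (hS : Tendsto (fun i => (P i).real (S i)) l (𝓝 1))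
    (hST : Tendsto (fun i => (P i).real (S i \ T i)) l (𝓝 0)) :
    Tendsto (fun i => (P i).real (T i)) l (𝓝 1) := by
  refine tendsto_of_tendsto_of_tendsto_of_le_of_le (by simpa using hS.sub hST)
    tendsto_const_nhds (fun i => ?_) fun i => measureReal_le_one
  rw [sub_le_iff_le_add']
  exact (measureReal_mono (by simp)).trans (measureReal_union_le (S i \ T i) (T i))

theorem tendsto_atTop_of_tendsto_div {k : ℕ → ℕ} {c : ℝ} (hc : 0 < c)
    (h : Tendsto (fun ℓ : ℕ => (k ℓ : ℝ) / ℓ) atTop (𝓝 c)) : Tendsto k atTop atTop := by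
  rw [← tendsto_natCast_atTop_iff (R := ℝ)]
  refine (h.pos_mul_atTop hc tendsto_natCast_atTop_atTop).congr' ?_
  filter_upwards [eventually_ne_atTop 0] with ℓ hℓ
  exact div_mul_cancel₀ _ (Nat.cast_ne_zero.2 hℓ)

theorem tendsto_measureReal_one_iff {ι : Type*} {l : Filter ι} {Ω : ι → Type*}
    [∀ i, MeasurableSpace (Ω i)] {P : ∀ i, Measure (Ω i)} [∀ i, IsProbabilityMeasure (P i)]
    {S : ∀ i, Set (Ω i)} :
    Tendsto (fun i => (P i).real (S i)) l (𝓝 1) ↔ Tendsto (fun i => P i (S i)) l (𝓝 1) :=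
  ENNReal.tendsto_toReal_iff (fun _ => measure_ne_top _ _) ENNReal.one_ne_top

theorem two_mul_div_rpow_le {N b α : ℝ} {ℓ : ℕ} (hb : 0 ≤ b) (hN : 0 < N) (hNb : N ≤ 4 * b ^ ℓ)
    (hα : α ≤ 1) : 2 * N / N ^ α ≤ 2 * 4 ^ (1 - α) * b ^ ((1 - α) * ℓ) :=
  calc 2 * N / N ^ α = 2 * N ^ (1 - α) := by
        rw [Real.rpow_sub hN, Real.rpow_one, mul_div_assoc]
    _ ≤ 2 * (4 * b ^ ℓ) ^ (1 - α) := by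
        gcongr
    _ = 2 * 4 ^ (1 - α) * b ^ ((1 - α) * ℓ) := by
        rw [Real.mul_rpow zero_le_four (by positivity), ← Real.rpow_natCast b ℓ,
          ← Real.rpow_mul hb, mul_comm (ℓ : ℝ), mul_assoc]

theorem pow_le_mul_pow {b K θ ε : ℝ} {ℓ j E : ℕ} (hb : 1 ≤ b) (hK : 0 ≤ K) (hj : 0 < j)
    (hE : (θ + ε) * j * ℓ ≤ E) (hsmall : K * b ^ (-ε * ℓ) ≤ 1) :
    (K * b ^ (θ * ℓ)) ^ j ≤ K * b ^ (-ε * ℓ) * b ^ E := by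
  have hb0 : 0 < b := zero_lt_one.trans_le hb
  have hsplit : K * b ^ (θ * ℓ) = K * b ^ (-ε * ℓ) * b ^ ((θ + ε) * ℓ) := by
    rw [mul_assoc, ← Real.rpow_add hb0]
    ring_nf
  calc (K * b ^ (θ * ℓ)) ^ j = (K * b ^ (-ε * ℓ)) ^ j * b ^ ((θ + ε) * j * ℓ) := by
        rw [hsplit, mul_pow, ← Real.rpow_mul_natCast hb0.le, mul_right_comm]
    _ ≤ K * b ^ (-ε * ℓ) * b ^ (E : ℝ) := by
        gcongr
        exact pow_le_of_le_one (by positivity) hsmall hj.ne'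
    _ = K * b ^ (-ε * ℓ) * b ^ E := by rw [Real.rpow_natCast]

theorem tendsto_const_mul_rpow_neg {b ε : ℝ} (K : ℝ) (hb : 1 < b) (hε : 0 < ε) :
    Tendsto (fun ℓ : ℕ => K * b ^ (-ε * ℓ)) atTop (𝓝 0) := by
  have hpow : Tendsto (fun ℓ : ℕ => (b ^ (-ε)) ^ ℓ) atTop (𝓝 0) :=
    tendsto_pow_atTop_nhds_zero_of_lt_one (by positivity)
      (Real.rpow_lt_one_of_one_lt_of_neg hb (neg_neg_of_pos hε))
  have hmul := hpow.const_mul K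
  rw [mul_zero] at hmul
  exact hmul.congr fun ℓ => by rw [Real.rpow_mul_natCast (zero_le_one.trans hb.le)]

variable {m : ℕ}

theorem tendsto_card_B (hm : 0 < m) :
    Tendsto (fun ℓ => (Nat.card (B m ℓ) : ℝ)) atTop atTop :=
  tendsto_atTop_mono (fun ℓ => Nat.cast_le.2 (lt_card_B hm ℓ).le) tendsto_natCast_atTop_atTop

variable {d : ℝ} {Ω : ℕ → Type*} [∀ ℓ, MeasurableSpace (Ω ℓ)] {P : ∀ ℓ, Measure (Ω ℓ)}
  [∀ ℓ, IsProbabilityMeasure (P ℓ)] {R : ∀ ℓ, Ω ℓ → Set (B m ℓ)}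

theorem IsRandomRelators.tendsto_measureReal_rpow_le (hR : IsRandomRelators m d P R) (hm : 0 < m)
    {α : ℝ} (hα : α < d) :
    Tendsto (fun ℓ => (P ℓ).real {ω | (Nat.card (B m ℓ) : ℝ) ^ α ≤ (R ℓ ω).ncard}) atTop
      (𝓝 1) := by
  refine tendsto_of_tendsto_of_tendsto_of_le_of_le'
    (tendsto_measureReal_one_iff.2 (hR.densable (d - α) (sub_pos.2 hα))) tendsto_const_nhds ?_
    (Eventually.of_forall fun _ => measureReal_le_one)
  filter_upwards [(tendsto_card_B hm).eventually_gt_atTop 1] with ℓ hℓ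
  refine measureReal_mono fun ω ⟨hne, hω⟩ => ?_
  have hpos : (0 : ℝ) < (R ℓ ω).ncard := by
    exact_mod_cast (Set.ncard_pos (Set.toFinite _)).2 hne
  rw [Set.mem_ofPred_eq, ← Real.le_logb_iff_rpow_le hℓ hpos]
  linarith [(abs_le.1 hω).1]

theorem IsRandomRelators.density_le_one (hR : IsRandomRelators m d P R) (hm : 0 < m) : d ≤ 1 := by
  refine le_of_forall_lt_imp_le_of_dense fun α hα => ?_
  have hpos := (hR.tendsto_measureReal_rpow_le hm hα).eventually_ne one_ne_zero
  obtain ⟨ℓ, hℓ, hcard⟩ :=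
    (hpos.and ((tendsto_card_B hm).eventually_gt_atTop 1)).exists
  obtain ⟨ω, hω⟩ := nonempty_of_measureReal_ne_zero hℓ
  refine (Real.rpow_le_rpow_left_iff hcard).1 (hω.trans ?_)
  rw [Real.rpow_one]
  exact_mod_cast Set.ncard_le_card (R ℓ ω)

namespace TwoComplex

variable {Y : TwoComplex}

theorem IsPlanar.le_sum_bdryEdges {n : Y.E → ℕ+} (hY : (Y.subdivide n).IsPlanar) {ℓ : ℕ}
    (hlength : ∀ f, ((Y.subdivide n).bdry f).length = ℓ) {c : ℝ}
    (hiso : ∀ Z : (Y.subdivide n).Sub, c * (Z.faces.ncard : ℝ) * (ℓ : ℝ) ≤ (Z.bdryLength : ℝ))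
    (A : Finset Y.F) :
    (1 + c) / 2 * A.card * ℓ ≤ ((∑ e ∈ bdryEdges A, (n e : ℕ) : ℕ) : ℝ) := by
  rw [← card_bdryEdges_subdivide]
  refine hY.le_card_bdryEdges hlength (Eq.trans_le ?_ (hiso (closure (Y := Y.subdivide n) A)))
  rw [show (closure (Y := Y.subdivide n) A).faces.ncard = A.card from Set.ncard_coe_finset A]
  rfl

variable {n : ℕ → Y.E → ℕ+} {s : ℝ}

theorem eventually_two_mul_card_le (hm : 0 < m)
    (hlength : ∀ᶠ ℓ in atTop, ∀ f, ((Y.subdivide (n ℓ)).bdry f).length ≤ ℓ) (hs : 0 < s)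
    (hedges : ∀ᶠ ℓ : ℕ in atTop, ∀ A : Finset Y.F,
      (1 - d + s) * A.card * ℓ ≤ ((∑ e ∈ bdryEdges A, (n ℓ e : ℕ) : ℕ) : ℝ)) :
    ∀ᶠ ℓ in atTop, 2 * (Nat.card Y.F : ℝ) ≤ (Nat.card (B m ℓ) : ℝ) ^ (d - s / 2) := by
  rcases isEmpty_or_nonempty Y.F with hF | ⟨⟨f⟩⟩
  · exact Eventually.of_forall fun ℓ => by simp [Real.rpow_nonneg]
  have hsd : s ≤ d := by
    obtain ⟨ℓ, hℓ, hlen, hpos⟩ := (hedges.and (hlength.and (eventually_gt_atTop 0))).exists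
    have hle : (1 - d + s) * ℓ ≤ 1 * ℓ := by
      calc (1 - d + s) * ℓ ≤ ((∑ e ∈ bdryEdges {f}, (n ℓ e : ℕ) : ℕ) : ℝ) := by
            simpa using hℓ {f}
        _ ≤ 1 * ℓ := by
            rw [one_mul, ← card_bdryEdges_subdivide]
            exact_mod_cast (card_bdryEdges_singleton_le (Y := Y.subdivide (n ℓ)) f).trans (hlen f)
    linarith [le_of_mul_le_mul_right hle (Nat.cast_pos.2 hpos)]
  exact ((tendsto_rpow_atTop (by linarith)).comp (tendsto_card_B hm)).eventually_ge_atTop _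

theorem tendsto_measureReal_not_fillable (hm : 2 ≤ m) {col : Y.Dart → Fin m × Bool}
    (hcol : Y.IsCornerColoring col) (hbdry : Function.Injective Y.orientedBdry)
    (hR : IsRandomRelators m d P R)
    (hn : ∀ e, Tendsto (fun ℓ => (n ℓ e : ℕ)) atTop atTop)
    (hlength : ∀ᶠ ℓ in atTop, ∀ f, ((Y.subdivide (n ℓ)).bdry f).length ≤ ℓ) (hs : 0 < s)
    (hedges : ∀ᶠ ℓ : ℕ in atTop, ∀ A : Finset Y.F,
      (1 - d + s) * A.card * ℓ ≤ ((∑ e ∈ bdryEdges A, (n ℓ e : ℕ) : ℕ) : ℝ)) :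
    Tendsto (fun ℓ => (P ℓ).real {ω | (Nat.card (B m ℓ) : ℝ) ^ (d - s / 2) ≤ (R ℓ ω).ncard ∧
      ¬ (Y.subdivide (n ℓ)).Fillable m (Subtype.val '' R ℓ ω)}) atTop (𝓝 0) := by
  obtain ⟨C⟩ := hcol.nonempty_cornerCode hm
  set b : ℝ := ((2 * m - 1 : ℕ) : ℝ)
  have hb : 1 < b := Nat.one_lt_cast.2 (by lia)
  set θ := 1 - (d - s / 2)
  set K : ℝ := 2 * 4 ^ θ
  have hsmall := tendsto_const_mul_rpow_neg K hb (half_pos hs)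
  have hbound := (hsmall.const_mul ((b ^ (2 * C.q + 1)) ^ Nat.card Y.E)).const_mul
    ((2 : ℝ) ^ Nat.card Y.F * (Nat.card Y.F : ℝ) ^ Nat.card Y.F)
  rw [mul_zero, mul_zero] at hbound
  refine squeeze_zero' (Eventually.of_forall fun ℓ => measureReal_nonneg) ?_ hbound
  filter_upwards [eventually_all.2 fun e => (hn e).eventually_ge_atTop (2 * C.q + 1), hlength,
    hedges, eventually_two_mul_card_le (m := m) (by lia) hlength hs hedges,
    (tendsto_card_B (m := m) (by lia)).eventually_gt_atTop 0, hsmall.eventually_le_const one_pos]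
    with ℓ hnℓ hlengthℓ hedgesℓ hcard hpos hsmallℓ
  refine C.measureReal_not_fillable_le hm hbdry hnℓ hlengthℓ (hR.measurable ℓ) (hR.invariant ℓ)
    (by positivity) hcard (by positivity) fun A hA => ?_
  have hratio := two_mul_div_rpow_le (b := b) (ℓ := ℓ) (α := d - s / 2) (by positivity) hpos
    ((Nat.cast_le.2 (card_B_le hm ℓ)).trans_eq
      (by simp only [b, Nat.cast_mul, Nat.cast_pow, Nat.cast_ofNat]))
    (by linarith [hR.density_le_one (by lia)])
  refine (pow_le_pow_left₀ (by positivity) hratio _).trans ?_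
  refine pow_le_mul_pow hb.le (by positivity) hA.card_pos (le_of_eq_of_le ?_ (hedgesℓ A)) hsmallℓ
  ring

theorem tendsto_measure_fillable (hm : 2 ≤ m) {col : Y.Dart → Fin m × Bool}
    (hcol : Y.IsCornerColoring col) (hbdry : Function.Injective Y.orientedBdry)
    (hR : IsRandomRelators m d P R)
    (hn : ∀ e, Tendsto (fun ℓ => (n ℓ e : ℕ)) atTop atTop)
    (hlength : ∀ᶠ ℓ in atTop, ∀ f, ((Y.subdivide (n ℓ)).bdry f).length ≤ ℓ) (hs : 0 < s)
    (hedges : ∀ᶠ ℓ : ℕ in atTop, ∀ A : Finset Y.F,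
      (1 - d + s) * A.card * ℓ ≤ ((∑ e ∈ bdryEdges A, (n ℓ e : ℕ) : ℕ) : ℝ)) :
    Tendsto (fun ℓ => P ℓ {ω | (Y.subdivide (n ℓ)).Fillable m (Subtype.val '' R ℓ ω)}) atTop
      (𝓝 1) :=
  tendsto_measureReal_one_iff.1 <| tendsto_measureReal_one
    (hR.tendsto_measureReal_rpow_le (by lia) (sub_lt_self d (half_pos hs)))
    (tendsto_measureReal_not_fillable hm hcol hbdry hR hn hlength hs hedges)

end TwoComplex
end Limit

end RandomGroups

open RandomGroups in
theorem mainTheorem6_general {m : ℕ} (hm : 2 ≤ m) {d : ℝ} {Ω : ℕ → Type*}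
    [∀ ℓ, MeasurableSpace (Ω ℓ)] {P : ∀ ℓ, Measure (Ω ℓ)} [∀ ℓ, IsProbabilityMeasure (P ℓ)]
    {R : ∀ ℓ, Ω ℓ → Set (B m ℓ)} (hR : IsRandomRelators m d P R) {s : ℝ} (hs : 0 < s)
    {Y : TwoComplex} {n : ℕ → Y.E → ℕ+} (hn : ∀ e, Tendsto (fun ℓ => (n ℓ e : ℕ)) atTop atTop)
    {D : ℕ → TwoComplex} (hD : ∀ᶠ ℓ in atTop, D ℓ = Y.subdivide (n ℓ))
    (hplanar : ∀ᶠ ℓ in atTop, (D ℓ).IsPlanar)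
    (hlength : ∀ᶠ ℓ in atTop, ∀ f, ((D ℓ).bdry f).length = ℓ)
    (hiso : ∀ᶠ ℓ in atTop, ∀ Z : (D ℓ).Sub,
      (1 - 2 * d + s) * (Z.faces.ncard : ℝ) * (ℓ : ℝ) ≤ (Z.bdryLength : ℝ)) :
    Tendsto (fun ℓ => P ℓ {ω | (D ℓ).Fillable m (Subtype.val '' R ℓ ω)}) atTop (𝓝 1) := by
  have hgeom : ∀ᶠ ℓ : ℕ in atTop, (Y.subdivide (n ℓ)).IsPlanar ∧
      (∀ f, ((Y.subdivide (n ℓ)).bdry f).length ≤ ℓ) ∧ ∀ A : Finset Y.F,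
        (1 - d + s / 2) * A.card * ℓ ≤
          ((∑ e ∈ TwoComplex.bdryEdges A, (n ℓ e : ℕ) : ℕ) : ℝ) := by
    filter_upwards [hD, hplanar, hlength, hiso] with ℓ hDℓ hY hlengthℓ hisoℓ
    rw [hDℓ] at hY hlengthℓ hisoℓ
    refine ⟨hY, fun f => (hlengthℓ f).le, fun A => ?_⟩
    convert hY.le_sum_bdryEdges hlengthℓ hisoℓ A using 3
    ring
  obtain ⟨ℓ, hY, -⟩ := hgeom.exists
  have hcolors : 3 ≤ Nat.card (Fin m × Bool) := by
    rw [Nat.card_prod, Nat.card_fin, Nat.card_eq_fintype_card, Fintype.card_bool]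
    lia
  obtain ⟨col, hcol⟩ := hY.exists_isCornerColoring hcolors
  refine (TwoComplex.tendsto_measure_fillable hm hcol.of_subdivide
    (TwoComplex.orientedBdry_injective_of_subdivide hY.orientedBdry_injective) hR hn
    (hgeom.mono fun _ h => h.2.1) (half_pos hs) (hgeom.mono fun _ h => h.2.2)).congr' ?_
  filter_upwards [hD] with ℓ hDℓ
  rw [hDℓ]

theorem mainTheorem6 (m : ℕ) (hm : 2 ≤ m) (d : ℝ) {Ω : ℕ → Type*}
    [∀ ℓ, MeasurableSpace (Ω ℓ)] (P : ∀ ℓ, Measure (Ω ℓ)) [∀ ℓ, IsProbabilityMeasure (P ℓ)]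
    (R : ∀ ℓ, Ω ℓ → Set (RandomGroups.B m ℓ)) (hR : RandomGroups.IsRandomRelators m d P R)
    (s : ℝ) (hs : 0 < s) (D : ℕ → RandomGroups.TwoComplex)
    (hD : RandomGroups.SameGeometricForm D) (hplanar : ∀ᶠ ℓ in atTop, (D ℓ).IsPlanar)
    (hlength : ∀ᶠ ℓ in atTop, ∀ f, ((D ℓ).bdry f).length = ℓ)
    (hiso : ∀ᶠ ℓ in atTop, ∀ Z : (D ℓ).Sub,
      (1 - 2 * d + s) * (Z.faces.ncard : ℝ) * (ℓ : ℝ) ≤ (Z.bdryLength : ℝ)) :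
    Tendsto (fun ℓ => P ℓ {ω | (D ℓ).Fillable m (Subtype.val '' R ℓ ω)}) atTop (𝓝 1) := by
  obtain ⟨Φ, n, hn, hform⟩ := hD
  exact mainTheorem6_general hm hR hs (fun e => RandomGroups.tendsto_atTop_of_tendsto_div
    (Φ.len_pos e) (hn e)) (hform.mono fun _ h => h.1) hplanar hlength hiso
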